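/- Let $K$ be a field, let $G$ be a finite simple graph on the vertex set $V=\{x_1,\dots,x_n\}$, and let $S=K[x_1,\dots,x_n]$. Suppose that $G$ is * a Cameron–Walker graph, i.e. $G$ is connected, the largest number of edges of an induced matching of $G$ (a matching that is an induced subgraph of $G$) equals the largest number of edges of a matching of $G$, and $G$ is neither a star (a graph in which one vertex is adjacent to all other vertices and there are no further edges; a single vertex counts as a star) nor a star triangle (a union of triangles that share exactly one common vertex); and * Cohen–Macaulay over $K$, i.e. $S/(x_ix_j : \{x_i,x_j\}\in E(G))$ is a Cohen–Macaulay ring. Let $I_G\subset S$ be the vertex cover ideal of $G$, generated by the monomials $u_C=\prod_{x_i\in C}x_i$, where $C$ ranges over the minimal vertex covers of $G$. Then every power $I_G^k$, $k\ge 0$, has a linear resolution: for some $d$ (depending on $k$) the minimal graded free resolution of $I_G^k$ over $S$ has the form $$\cdots\to S(-d-2)^{b_2}\to S(-d-1)^{b_1}\to S(-d)^{b_0}\to I_G^k\to 0 .$$ -/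

import Mathlib

namespace CoverIdeal

section Graphs

variable {V : Type*}

/-- The matching number `m(G)`: the largest number of edges of a matching of `G`. -/
noncomputable def matchingNumber (G : SimpleGraph V) : ℕ :=
  sSup {n | ∃ M : G.Subgraph, M.IsMatching ∧ M.edgeSet.ncard = n}

/-- The induced matching number `im(G)`: the largest number of edges of a matching of `G`
that is an induced subgraph of `G`. -/
noncomputable def inducedMatchingNumber (G : SimpleGraph V) : ℕ :=
  sSup {n | ∃ M : G.Subgraph, M.IsMatching ∧ M.IsInduced ∧ M.edgeSet.ncard = n}

/-- A star: some centre `c` is joined to all other vertices, and there are no further edges. -/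
def IsStar (G : SimpleGraph V) : Prop :=
  ∃ c : V, ∀ v w : V, G.Adj v w ↔ v ≠ w ∧ (v = c ∨ w = c)

/-- A star triangle: triangles that share one common vertex `c` and are otherwise disjoint.
Each vertex other than `c` is adjacent to `c` and to exactly one further vertex. -/
def IsStarTriangle (G : SimpleGraph V) : Prop :=
  ∃ c : V, ∀ v : V, v ≠ c → G.Adj v c ∧ ∃! w : V, w ≠ c ∧ G.Adj v w

/-- Cameron–Walker graphs: connected graphs with `im(G) = m(G)`, other than stars and
star triangles. -/
structure IsCameronWalker (G : SimpleGraph V) : Prop where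
  connected : G.Connected
  inducedMatchingNumber_eq : inducedMatchingNumber G = matchingNumber G
  not_isStar : ¬ IsStar G
  not_isStarTriangle : ¬ IsStarTriangle G

end Graphs

section CohenMacaulay

/-- The depth of a local ring: the supremum of the lengths of the regular sequences
in its maximal ideal. -/
noncomputable def localDepth (R : Type*) [CommRing R] [IsLocalRing R] : ℕ∞ :=
  ⨆ rs ∈ {rs : List R | RingTheory.Sequence.IsRegular R rs ∧
    ∀ r ∈ rs, r ∈ IsLocalRing.maximalIdeal R}, (rs.length : ℕ∞)

/-- A Cohen–Macaulay ring: a Noetherian ring whose localizations at maximal ideals have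
depth equal to their Krull dimension. -/
structure IsCohenMacaulayRing (R : Type*) [CommRing R] : Prop where
  noetherian : IsNoetherianRing R
  depth_eq_dim : ∀ (p : Ideal R) [p.IsMaximal],
    (localDepth (Localization.AtPrime p) : WithBot ℕ∞) = ringKrullDim (Localization.AtPrime p)

end CohenMacaulay

section Ideals

variable (K : Type*) [Field K] {V : Type*}

/-- The edge ideal of `G`, generated by the products `x_v x_w` with `{v, w}` an edge. -/
noncomputable def edgeIdeal (G : SimpleGraph V) : Ideal (MvPolynomial V K) :=
  Ideal.span {f | ∃ v w : V, G.Adj v w ∧ f = MvPolynomial.X v * MvPolynomial.X w}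

/-- `G` is Cohen–Macaulay over `K` if the quotient of the polynomial ring by the edge ideal
is a Cohen–Macaulay ring. -/
def IsCohenMacaulayGraph (G : SimpleGraph V) : Prop :=
  IsCohenMacaulayRing (MvPolynomial V K ⧸ edgeIdeal K G)

/-- The (vertex) cover ideal of `G`, generated by the monomials `∏_{v ∈ C} x_v`,
`C` a minimal vertex cover of `G`. -/
noncomputable def coverIdeal (G : SimpleGraph V) : Ideal (MvPolynomial V K) :=
  Ideal.span {f | ∃ C : Finset V, Minimal (fun D : Finset V => G.IsVertexCover (D : Set V)) C ∧
    f = ∏ v ∈ C, MvPolynomial.X v}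

variable {K}

/-- `I` has a linear resolution: for some `d` there is an exact sequence
`⋯ → S(-d-2)^{b 2} → S(-d-1)^{b 1} → S(-d)^{b 0} → I → 0` of graded modules over the polynomial
ring `S`. A degree-preserving map `S(-d-i-1)^{b (i+1)} → S(-d-i)^{b i}` is a matrix whose entries
are linear forms (or zero), and a degree-preserving map `S(-d)^{b 0} → I` is a tuple of forms of
degree `d` in `I`. Such a resolution is automatically minimal, the entries of its matrices being
in the ideal generated by the variables. -/
def HasLinearResolution (I : Ideal (MvPolynomial V K)) : Prop :=
  ∃ (d : ℕ) (b : ℕ → ℕ) (g : Fin (b 0) → MvPolynomial V K)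
    (A : ∀ i : ℕ, Matrix (Fin (b i)) (Fin (b (i + 1))) (MvPolynomial V K)),
    (∀ j, (g j).IsHomogeneous d) ∧
    (∀ i j k, (A i j k).IsHomogeneous 1) ∧
    Ideal.span (Set.range g) = I ∧
    Function.Exact (A 0).mulVecLin (Fintype.linearCombination (MvPolynomial V K) g) ∧
    ∀ i, Function.Exact (A (i + 1)).mulVecLin (A i).mulVecLin

end Ideals

end CoverIdeal

/-! The hypotheses force `G` to be a bipartite graph with one leaf hung on each vertex of one side
(the stems) and one triangle on each vertex of the other (the apexes). For such graphs every power
of the cover ideal has linear quotients.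

Combinatorics: an induced matching that is also a largest one leaves an independent set `U` of
unmatched vertices, and an augmenting path of length three shows that the two ends of a matching
edge are never adjacent to different vertices of `U`. Cohen–Macaulayness makes all minimal vertex
covers equally large (`IsCohenMacaulayGraph.card_le_card`), because depth is at most `dim R ⧸ p` for
every associated prime `p`. Exchanging vertices in minimal covers then shows that each `u ∈ U` spans
a triangle with exactly one matching edge. Each remaining matching edge has exactly one end with a
neighbour in `U`, so it joins a stem to its leaf.

Algebra: a minimal cover contains one end of each stem–leaf edge and two vertices of each triangle.
Hence the exponents of the generators of the `k`-th power satisfy the linear conditions of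
`IsExponent`; conversely every integral solution splits into `k` covers
(`IsExponent.exists_eq_add`). In the order of decreasing weight these monomials have linear
quotients: a coordinate that is too small can be raised at the cost of a vertex of smaller weight in
the same block (`IsExponent.exchange`). Linear quotients give a linear resolution by iterated
mapping cones (`HasLinearResolutionOfDegree.sup_span_singleton`). -/

namespace CoverIdeal

/-! ### Linear resolutions and mapping cones. -/

section LinearResolutions

variable {K : Type*} [Field K] {V : Type*}

attribute [local instance] MvPolynomial.gradedAlgebra

open MvPolynomial in
lemma homogeneousComponent_mul_of_isHomogeneous {a : MvPolynomial V K} {d : ℕ}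
    (ha : a.IsHomogeneous d) (e : ℕ) (p : MvPolynomial V K) :
    homogeneousComponent (d + e) (a * p) = a * homogeneousComponent e p := by
  classical
  have := DirectSum.coe_decompose_mul_add_of_left_mem (homogeneousSubmodule V K) (a := a)
    (b := p) (i := d) (j := e) ha
  rwa [← decomposition.decompose'_apply, ← decomposition.decompose'_apply]

/-- Solutions of a homogeneous linear system with homogeneous right-hand side can be chosen
homogeneous. -/
lemma exists_isHomogeneous_mul_eq {l m n : Type*} [Fintype m] {A : Matrix l m (MvPolynomial V K)}
    {Y : Matrix l n (MvPolynomial V K)} {d e : ℕ} (hA : ∀ i j, (A i j).IsHomogeneous d)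
    (hY : ∀ i j, (Y i j).IsHomogeneous (d + e)) (h : ∀ j, ∃ x, A.mulVec x = fun i => Y i j) :
    ∃ X : Matrix m n (MvPolynomial V K), (∀ i j, (X i j).IsHomogeneous e) ∧ A * X = Y := by
  choose x hx using h
  refine ⟨Matrix.of fun i j => MvPolynomial.homogeneousComponent e (x j i),
    fun i j => MvPolynomial.homogeneousComponent_isHomogeneous _ _, ?_⟩
  ext1 i j
  rw [← MvPolynomial.homogeneousComponent_eq_self (hY i j), ← congrFun (hx j) i,
    Matrix.mul_apply, Matrix.mulVec, dotProduct, map_sum]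
  exact Finset.sum_congr rfl fun k _ =>
    (homogeneousComponent_mul_of_isHomogeneous (hA i k) e _).symm

/-- `I` has a linear resolution with generators of degree `d`; the free modules are indexed by
arbitrary finite types. -/
def HasLinearResolutionOfDegree (d : ℕ) (I : Ideal (MvPolynomial V K)) : Prop :=
  ∃ (ι : ℕ → Type) (_ : ∀ i, Fintype (ι i)) (g : Matrix Unit (ι 0) (MvPolynomial V K))
    (A : ∀ i : ℕ, Matrix (ι i) (ι (i + 1)) (MvPolynomial V K)),
    (∀ i j, (g i j).IsHomogeneous d) ∧
    (∀ i j k, (A i j k).IsHomogeneous 1) ∧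
    (∀ f, f ∈ I ↔ ∃ x, g.mulVec x = fun _ => f) ∧
    (∀ x, g.mulVec x = 0 ↔ ∃ y, (A 0).mulVec y = x) ∧
    ∀ i x, (A i).mulVec x = 0 ↔ ∃ y, (A (i + 1)).mulVec y = x

/-- Mapping cones produce sum types as index types; reindexing along bijections with `Fin` returns
to the official definition. -/
lemma HasLinearResolutionOfDegree.hasLinearResolution {d : ℕ} {I : Ideal (MvPolynomial V K)}
    (h : HasLinearResolutionOfDegree d I) : HasLinearResolution I := by
  obtain ⟨ι, _, g, A, hg, hA, hI, h0, hs⟩ := h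
  let e : ∀ i, ι i ≃ Fin (Fintype.card (ι i)) := fun i => Fintype.equivFin _
  have key : ∀ (i : ℕ) (l : Type) (M : Matrix l (ι i) (MvPolynomial V K)) (r : Type) (t : r → l)
      (x : Fin (Fintype.card (ι i)) → MvPolynomial V K),
      (M.submatrix t (e i).symm).mulVec x = (M.mulVec (x ∘ e i)) ∘ t := by
    intro i l M r t x
    ext1 k
    simp only [Matrix.mulVec, dotProduct, Matrix.submatrix_apply, Function.comp]
    exact Fintype.sum_equiv (e i).symm _ _ fun y => by simp
  have hcomp : ∀ {l r : Type} (t : l ≃ r) (x : r → MvPolynomial V K), x ∘ t = 0 ↔ x = 0 := by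
    intro l r t x
    constructor
    · intro h; ext1 k; simpa using congrFun h (t.symm k)
    · rintro rfl; rfl
  have hex : ∀ (i : ℕ) (x : Fin (Fintype.card (ι i)) → MvPolynomial V K),
      (∃ y, (A i).mulVec y = x ∘ e i) ↔
      x ∈ Set.range ((A i).submatrix (e i).symm (e (i + 1)).symm).mulVecLin := by
    intro i x
    constructor
    · rintro ⟨y, hy⟩
      refine ⟨y ∘ (e (i + 1)).symm, ?_⟩
      rw [Matrix.mulVecLin_apply, key (i + 1)]
      have : (y ∘ (e (i + 1)).symm) ∘ e (i + 1) = y := by ext1; simp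
      rw [this, hy]; ext1; simp
    · rintro ⟨y, hy⟩
      rw [Matrix.mulVecLin_apply, key (i + 1)] at hy
      refine ⟨y ∘ e (i + 1), ?_⟩
      rw [← hy]; ext1; simp
  have hlin : ∀ x, Fintype.linearCombination (MvPolynomial V K)
      (fun j => g () ((e 0).symm j)) x = g.mulVec (x ∘ e 0) () := by
    intro x
    rw [Fintype.linearCombination_apply, Matrix.mulVec, dotProduct]
    refine Fintype.sum_equiv (e 0).symm _ _ fun y => ?_
    simp [mul_comm]
  refine ⟨d, fun i => Fintype.card (ι i), fun j => g () ((e 0).symm j),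
    fun i => (A i).submatrix (e i).symm (e (i + 1)).symm, fun j => hg _ _, fun i j k => hA _ _ _,
    ?_, ?_, ?_⟩
  · ext f
    rw [hI, Ideal.span, ← Fintype.range_linearCombination, LinearMap.mem_range]
    constructor
    · rintro ⟨x, hx⟩
      exact ⟨x ∘ e 0, by ext1; rw [← hx, hlin]⟩
    · rintro ⟨x, hx⟩
      refine ⟨x ∘ (e 0).symm, ?_⟩
      rw [hlin]
      have : (x ∘ (e 0).symm) ∘ e 0 = x := by ext1; simp
      rw [this, hx]
  · intro x
    rw [hlin, ← hex, ← h0]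
    exact ⟨fun h => funext fun _ => h, fun h => congrFun h ()⟩
  · intro i x
    rw [← hex, ← hs, Matrix.mulVecLin_apply]
    change ((A i).submatrix (e i).symm (e (i + 1)).symm).mulVec x = 0 ↔ _
    rw [key (i + 1), hcomp (e i).symm]

lemma hasLinearResolutionOfDegree_bot (d : ℕ) :
    HasLinearResolutionOfDegree d (⊥ : Ideal (MvPolynomial V K)) := by
  refine ⟨fun _ => Empty, fun _ => inferInstance, 0, fun _ => 0, fun i j => j.elim,
    fun i j => j.elim, ?_, fun x => ?_, fun i x => ?_⟩
  · intro f
    simp only [Submodule.mem_bot, Matrix.zero_mulVec]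
    exact ⟨fun h => ⟨0, by ext1; simp [h]⟩, fun ⟨_, h⟩ => (congrFun h ()).symm⟩
  · exact ⟨fun _ => ⟨0, Subsingleton.elim _ _⟩, fun _ => by rw [Matrix.zero_mulVec]⟩
  · exact ⟨fun _ => ⟨0, Subsingleton.elim _ _⟩, fun _ => Subsingleton.elim _ _⟩

/-- The index types of a resolution of `S ⧸ J` obtained from those of a resolution of `J`. -/
def augmentedIndex (ι : ℕ → Type) : ℕ → Type
  | 0 => Unit
  | i + 1 => ι i

instance {ι : ℕ → Type} [h : ∀ i, Fintype (ι i)] : ∀ i, Fintype (augmentedIndex ι i)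
  | 0 => inferInstanceAs (Fintype Unit)
  | i + 1 => h i

/-- The matrices of a resolution of `S ⧸ J` obtained from those of a resolution of `J`. -/
def augmentedMatrix {R : Type*} {ι : ℕ → Type} (g : Matrix Unit (ι 0) R)
    (A : ∀ i, Matrix (ι i) (ι (i + 1)) R) :
    ∀ i, Matrix (augmentedIndex ι i) (augmentedIndex ι (i + 1)) R
  | 0 => g
  | i + 1 => A i

/-- The horseshoe construction: block triangular matrices connecting two linear resolutions. -/
lemma exists_connecting_matrices {ι τ : ℕ → Type} [∀ i, Fintype (ι i)] [∀ i, Fintype (τ i)]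
    {A : ∀ i, Matrix (ι i) (ι (i + 1)) (MvPolynomial V K)}
    {B : ∀ i, Matrix (τ i) (τ (i + 1)) (MvPolynomial V K)}
    (hA : ∀ i j k, (A i j k).IsHomogeneous 1) (hB : ∀ i j k, (B i j k).IsHomogeneous 1)
    (hAex : ∀ i x, (A i).mulVec x = 0 ↔ ∃ y, (A (i + 1)).mulVec y = x)
    (hBB : ∀ i, B i * B (i + 1) = 0)
    (X₀ : Matrix (ι 0) (τ 1) (MvPolynomial V K)) (hX₀ : ∀ i j, (X₀ i j).IsHomogeneous 1)
    (h₀ : ∀ j, ∃ y, (A 0).mulVec y = fun i => (X₀ * B 1) i j) :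
    ∃ X : ∀ i, Matrix (ι i) (τ (i + 1)) (MvPolynomial V K), X 0 = X₀ ∧
      (∀ i j k, (X i j k).IsHomogeneous 1) ∧ ∀ i, A i * X (i + 1) + X i * B (i + 1) = 0 := by
  -- The invariant of the recursion: linear entries, and columns of `X * B (i + 1)` in the image of
  -- `A i`, so that the next lift exists.
  let Q : ∀ i, Matrix (ι i) (τ (i + 1)) (MvPolynomial V K) → Prop := fun i X =>
    (∀ j k, (X j k).IsHomogeneous 1) ∧ ∀ j, ∃ y, (A i).mulVec y = fun l => (X * B (i + 1)) l j
  have step : ∀ i (X : {X // Q i X}), ∃ Y : {Y // Q (i + 1) Y},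
      A i * Y.1 + X.1 * B (i + 1) = 0 := by
    rintro i ⟨X, hX1, hX2⟩
    obtain ⟨Y, hY1, hY2⟩ := exists_isHomogeneous_mul_eq (d := 1) (e := 1) (hA i)
      (Y := X * B (i + 1)) (fun j k => by
        rw [Matrix.mul_apply]
        exact MvPolynomial.IsHomogeneous.sum _ _ _ fun l _ => (hX1 _ _).mul (hB _ _ _)) hX2
    refine ⟨⟨-Y, fun j k => (hY1 j k).neg, fun j => (hAex i _).1 ?_⟩, ?_⟩
    · have : A i * (-Y * B (i + 1 + 1)) = 0 := by
        rw [← Matrix.mul_assoc, Matrix.mul_neg, hY2, Matrix.neg_mul, Matrix.mul_assoc, hBB,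
          Matrix.mul_zero, neg_zero]
      ext1 l
      exact congrFun (congrFun this l) j
    · simp [hY2]
  choose f hf using step
  let X : ∀ i, {X // Q i X} := fun i => Nat.rec ⟨X₀, hX₀, h₀⟩ (fun i X => f i X) i
  exact ⟨fun i => (X i).1, rfl, fun i => (X i).2.1, fun i => hf i (X i)⟩

/-- If `I` and `I : m` have linear resolutions, with generators of degree `d = deg m` and `1`,
then so has `I + (m)`. -/
lemma HasLinearResolutionOfDegree.sup_span_singleton {d : ℕ} {I J : Ideal (MvPolynomial V K)}
    {m : MvPolynomial V K} (hI : HasLinearResolutionOfDegree d I) (hm : m.IsHomogeneous d)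
    (hJ : HasLinearResolutionOfDegree 1 J) (hcolon : ∀ f, f ∈ J ↔ f * m ∈ I) :
    HasLinearResolutionOfDegree d (I ⊔ Ideal.span {m}) := by
  obtain ⟨ι, _, g, A, hg, hA, hgI, hgA, hAA⟩ := hI
  obtain ⟨σ, _, c, C, hc, hC, hcJ, hcC, hCC⟩ := hJ
  -- Up to a shift of degrees, `B` resolves `S ⧸ J`, which is isomorphic to `(I + (m)) ⧸ I` via
  -- multiplication by `m`.
  let τ := augmentedIndex σ
  let B : ∀ i, Matrix (τ i) (τ (i + 1)) (MvPolynomial V K) := augmentedMatrix c C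
  have hB : ∀ i j k, (B i j k).IsHomogeneous 1 := by
    rintro (_ | i)
    · exact hc
    · exact hC i
  have hBex : ∀ i x, (B i).mulVec x = 0 ↔ ∃ y, (B (i + 1)).mulVec y = x := by
    rintro (_ | i)
    · exact hcC
    · exact hCC i
  have hBB : ∀ i, B i * B (i + 1) = 0 := by
    intro i
    classical
    apply Matrix.toLin'.injective
    ext1 j
    ext1
    simp only [Matrix.toLin'_mul, LinearMap.comp_apply, Matrix.toLin'_apply]
    rw [(hBex i _).2 ⟨_, rfl⟩]
    simp
    rfl
  let m' : Matrix Unit (τ 0) (MvPolynomial V K) := fun _ _ => m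
  have hm'c : ∀ x : τ 0 → MvPolynomial V K, m'.mulVec x = fun _ => x () * m := by
    intro x
    ext1 i
    change ∑ j : Unit, m * x j = _
    simp [mul_comm]
  -- The generators of `J` times `m` lie in `I`. Their coefficients in terms of `g` start the
  -- comparison map; its entries are linear because both sides have degree `d + 1`.
  obtain ⟨X₀, hX₀, hgX⟩ : ∃ X₀ : Matrix (ι 0) (τ 1) (MvPolynomial V K),
      (∀ i j, (X₀ i j).IsHomogeneous 1) ∧ g * X₀ = m' * B 0 := by
    refine exists_isHomogeneous_mul_eq hg (fun i j => ?_) fun j => ?_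
    · rw [Matrix.mul_apply]
      exact MvPolynomial.IsHomogeneous.sum _ _ _ fun l _ => hm.mul (hB _ _ _)
    · classical
      have h1 : B 0 () j * m ∈ I := by
        rw [← hcolon, hcJ]
        refine ⟨Pi.single j 1, ?_⟩
        ext1
        exact congrFun (Matrix.mulVec_single_one c j) _
      obtain ⟨x, hx⟩ := (hgI _).1 h1
      refine ⟨x, hx.trans ?_⟩
      ext1 i
      change _ = ∑ k : Unit, m * B 0 k j
      simp [mul_comm]
  obtain ⟨X, hX0, hX1, hX2⟩ := exists_connecting_matrices hA hB hAA hBB (-X₀)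
    (fun i j => (hX₀ i j).neg) (by
      intro j
      rw [← hgA]
      have : g * (-X₀ * B 1) = 0 := by
        rw [← Matrix.mul_assoc, Matrix.mul_neg, hgX, Matrix.neg_mul, Matrix.mul_assoc, hBB,
          Matrix.mul_zero, neg_zero]
      ext1 l
      exact congrFun (congrFun this l) j)
  have hgX' : ∀ y, g.mulVec ((X 0).mulVec y) + m'.mulVec ((B 0).mulVec y) = 0 := by
    intro y
    rw [hX0, Matrix.mulVec_mulVec, Matrix.mulVec_mulVec, Matrix.mul_neg, hgX, Matrix.neg_mulVec,
      neg_add_cancel]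
  have hAX : ∀ i y, (A i).mulVec ((X (i + 1)).mulVec y) + (X i).mulVec ((B (i + 1)).mulVec y)
      = 0 := by
    intro i y
    rw [Matrix.mulVec_mulVec, Matrix.mulVec_mulVec, ← Matrix.add_mulVec, hX2, Matrix.zero_mulVec]
  refine ⟨fun i => ι i ⊕ τ i, fun i => inferInstance, Matrix.fromCols g m',
    fun i => Matrix.fromBlocks (A i) (X i) 0 (B i), ?_, ?_, ?_, ?_, ?_⟩
  · rintro i (j | j)
    · exact hg i j
    · exact hm
  · rintro i (j | j) (k | k)
    · exact hA i j k
    · exact hX1 i j k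
    · exact MvPolynomial.isHomogeneous_zero _ _ _
    · exact hB i j k
  · intro f
    rw [Submodule.mem_sup]
    constructor
    · rintro ⟨y, hy, z, hz, rfl⟩
      obtain ⟨x, hx⟩ := (hgI _).1 hy
      obtain ⟨a, rfl⟩ := Ideal.mem_span_singleton'.1 hz
      refine ⟨Sum.elim x fun _ => a, ?_⟩
      rw [Matrix.fromCols_mulVec_sumElim, hx, hm'c]
      rfl
    · rintro ⟨x, hx⟩
      rw [Matrix.fromCols_mulVec, hm'c] at hx
      refine ⟨g.mulVec (x ∘ Sum.inl) (), (hgI _).2 ⟨_, rfl⟩, _, ?_, congrFun hx ()⟩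
      exact Ideal.mem_span_singleton'.2 ⟨_, rfl⟩
  · intro x
    rw [Matrix.fromCols_mulVec]
    constructor
    · intro hx
      have h1 : x (Sum.inr ()) ∈ J := by
        rw [hcolon, hgI]
        refine ⟨-(x ∘ Sum.inl), ?_⟩
        rw [Matrix.mulVec_neg, eq_neg_of_add_eq_zero_left hx, neg_neg, hm'c]
        rfl
      obtain ⟨y, hy'⟩ : ∃ y : τ (0 + 1) → MvPolynomial V K, (B 0).mulVec y = x ∘ Sum.inr :=
        (hcJ _).1 h1
      -- Subtracting the relation of the block matrix applied to `y` leaves a syzygy of `g` alone,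
      -- which lifts through `A 0`.
      have h2 := hgX' y
      rw [hy', ← hx, eq_comm, ← sub_eq_zero, add_sub_add_right_eq_sub, ← Matrix.mulVec_sub] at h2
      obtain ⟨z, hz⟩ := (hgA _).1 h2
      refine ⟨Sum.elim z y, ?_⟩
      rw [Matrix.fromBlocks_mulVec, Sum.elim_comp_inl, Sum.elim_comp_inr, hz, hy']
      ext1 (i | i) <;> simp
    · rintro ⟨y, rfl⟩
      rw [Matrix.fromBlocks_mulVec]
      simp only [Sum.elim_comp_inl, Sum.elim_comp_inr, Matrix.zero_mulVec, zero_add]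
      rw [Matrix.mulVec_add, (hgA _).2 ⟨_, rfl⟩, zero_add, hgX']
  · intro i x
    rw [Matrix.fromBlocks_mulVec]
    constructor
    · intro hx
      have e1 : (A i).mulVec (x ∘ Sum.inl) + (X i).mulVec (x ∘ Sum.inr) = 0 := by
        ext1 j; exact congrFun hx (Sum.inl j)
      have e2 : (B i).mulVec (x ∘ Sum.inr) = 0 := by
        ext1 j; simpa using congrFun hx (Sum.inr j)
      obtain ⟨y, hy⟩ := (hBex _ _).1 e2
      have h2 := hAX i y
      rw [hy, ← e1, eq_comm, ← sub_eq_zero, add_sub_add_right_eq_sub, ← Matrix.mulVec_sub] at h2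
      obtain ⟨z, hz⟩ := (hAA _ _).1 h2
      refine ⟨Sum.elim z y, ?_⟩
      rw [Matrix.fromBlocks_mulVec, Sum.elim_comp_inl, Sum.elim_comp_inr, hz, hy]
      ext1 (i | i) <;> simp
    · rintro ⟨y, rfl⟩
      rw [Matrix.fromBlocks_mulVec]
      simp only [Sum.elim_comp_inl, Sum.elim_comp_inr, Matrix.zero_mulVec, zero_add]
      rw [Matrix.mulVec_add, (hAA _ _).2 ⟨_, rfl⟩, zero_add, hAX, (hBex _ _).2 ⟨_, rfl⟩]
      ext1 (i | i) <;> rfl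

end LinearResolutions

/-! ### Linear quotients of monomial ideals. -/

section LinearQuotients

variable {K : Type*} [Field K] {V : Type*}

open MvPolynomial

/-- A new variable is a nonzerodivisor modulo the ideal of the earlier ones, so that ideal is its
own colon ideal and the mapping cone applies with `J = I`. -/
lemma hasLinearResolutionOfDegree_span_X_image (s : Finset V) :
    HasLinearResolutionOfDegree 1 (Ideal.span (X '' (s : Set V) : Set (MvPolynomial V K))) := by
  classical
  induction s using Finset.induction_on with
  | empty => simpa using hasLinearResolutionOfDegree_bot 1
  | insert x s hx ih =>
    rw [Finset.coe_insert, Set.image_insert_eq, Ideal.span_insert, sup_comm]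
    refine ih.sup_span_singleton (isHomogeneous_X _ _) ih fun f => ⟨fun h => Ideal.mul_mem_right _ _ h, ?_⟩
    intro h
    rw [mem_ideal_span_X_image] at h ⊢
    intro μ hμ
    obtain ⟨i, hi, h1⟩ := h (μ + Finsupp.single x 1) (by
      rw [mem_support_iff, coeff_mul_X]; exact mem_support_iff.1 hμ)
    refine ⟨i, hi, ?_⟩
    rwa [Finsupp.add_apply, Finsupp.single_eq_of_ne (by rintro rfl; exact hx hi), add_zero] at h1

/-- A monomial ideal generated in one degree with linear quotients has a linear resolution. -/
lemma hasLinearResolutionOfDegree_of_linear_quotients [Finite V] (d : ℕ) (φ : (V →₀ ℕ) → ℕ)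
    (s : Finset (V →₀ ℕ)) (hd : ∀ e ∈ s, e.degree = d)
    (h : ∀ e ∈ s, ∀ f ∈ s, e ≠ f → φ e ≤ φ f →
      ∃ g ∈ s, φ e < φ g ∧ ∃ x, e x < f x ∧ g ≤ e + Finsupp.single x 1) :
    HasLinearResolutionOfDegree d
      (Ideal.span ((fun e => monomial e (1 : K)) '' (s : Set (V →₀ ℕ)))) := by
  classical
  -- The generators are added by decreasing `φ`. Ties may be broken arbitrarily, since the exchange
  -- monomial `g` has strictly larger `φ` and is already present.
  induction s using Finset.induction_on_min_value φ with
  | empty => simpa using hasLinearResolutionOfDegree_bot d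
  | insert a s ha hmin ih =>
    have hs := ih (fun e he => hd e (Finset.mem_insert_of_mem he)) (by
      intro e he f hf hef hφ
      obtain ⟨g, hg, h1, h2⟩ := h e (Finset.mem_insert_of_mem he) f (Finset.mem_insert_of_mem hf)
        hef hφ
      refine ⟨g, (Finset.mem_insert.1 hg).resolve_left ?_, h1, h2⟩
      rintro rfl
      exact absurd (hmin e he) (not_le.2 h1))
    rw [Finset.coe_insert, Set.image_insert_eq, Ideal.span_insert, sup_comm]
    -- The variables that multiply the new monomial into the old ideal; the exchange hypothesis says
    -- that they generate the whole colon ideal.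
    let T : Set V := {x | ∃ g ∈ s, g ≤ a + Finsupp.single x 1}
    refine hs.sup_span_singleton (isHomogeneous_monomial _ (hd a (Finset.mem_insert_self _ _)))
      (J := Ideal.span (X '' T)) ?_ fun f => ⟨?_, ?_⟩
    · have := hasLinearResolutionOfDegree_span_X_image (K := K) T.toFinite.toFinset
      simpa using this
    · intro hf
      have : Ideal.span (X '' T) ≤ Submodule.comap (LinearMap.mulRight (MvPolynomial V K)
          (monomial a (1 : K))) (Ideal.span ((fun e => monomial e (1 : K)) '' (s : Set (V →₀ ℕ)))) := by
        rw [Ideal.span, Submodule.span_le]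
        rintro _ ⟨x, ⟨g, hg, hgx⟩, rfl⟩
        rw [SetLike.mem_coe, Submodule.mem_comap, LinearMap.mulRight_apply, X, monomial_mul, one_mul,
          add_comm, mem_ideal_span_monomial_image]
        intro μ hμ
        rw [mem_support_iff, coeff_monomial, ne_eq, ite_eq_right_iff, not_forall] at hμ
        exact ⟨g, hg, hμ.1 ▸ hgx⟩
      exact this hf
    · intro hf
      rw [mem_ideal_span_monomial_image] at hf
      rw [mem_ideal_span_X_image]
      intro μ hμ
      obtain ⟨f', hf', hle⟩ := hf (μ + a) (by
        rw [mem_support_iff, coeff_mul_monomial, mul_one]; exact mem_support_iff.1 hμ)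
      obtain ⟨g, hg, h1, x, h2, h3⟩ := h a (Finset.mem_insert_self _ _) f'
        (Finset.mem_insert_of_mem hf') (by rintro rfl; exact ha hf') (hmin _ hf')
      refine ⟨x, ⟨g, (Finset.mem_insert.1 hg).resolve_left ?_, h3⟩, ?_⟩
      · rintro rfl; exact lt_irrefl _ h1
      · have := hle x
        simp only [Finsupp.add_apply] at this
        omega

end LinearQuotients

/-! ### Powers of the cover ideal of a leaf–triangle graph. -/

section LeafTriangle

/-- The vertices of a disjoint union of edges `{stem i, leaf i}` and of triangles
`{apex j, left j, right j}`. -/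
inductive BlockVertex (ι κ : Type*)
  | stem (i : ι)
  | leaf (i : ι)
  | apex (j : κ)
  | left (j : κ)
  | right (j : κ)

/-- The pairs of vertices that may be adjacent in a graph obtained from a bipartite graph on
`ι ⊔ κ` by attaching a leaf to each vertex of `ι` and a triangle to each vertex of `κ`. -/
def BlockVertex.Compatible {ι κ : Type*} : BlockVertex ι κ → BlockVertex ι κ → Prop
  | stem i, leaf i' | leaf i, stem i' => i = i'
  | apex j, left j' | left j, apex j' => j = j'
  | apex j, right j' | right j, apex j' => j = j'
  | left j, right j' | right j, left j' => j = j'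
  | stem _, apex _ | apex _, stem _ => True
  | _, _ => False

/-- An identification of `G` with a graph obtained from a bipartite graph on `ι ⊔ κ` by attaching
a leaf to each vertex of `ι` and a triangle to each vertex of `κ`. -/
structure LeafTriangleDecomposition {V : Type*} (G : SimpleGraph V) (ι κ : Type*) where
  vertex : BlockVertex ι κ ≃ V
  adj_stem_leaf : ∀ i, G.Adj (vertex (.stem i)) (vertex (.leaf i))
  adj_apex_left : ∀ j, G.Adj (vertex (.apex j)) (vertex (.left j))
  adj_apex_right : ∀ j, G.Adj (vertex (.apex j)) (vertex (.right j))
  adj_left_right : ∀ j, G.Adj (vertex (.left j)) (vertex (.right j))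
  compatible : ∀ x y, G.Adj (vertex x) (vertex y) → x.Compatible y

namespace LeafTriangleDecomposition

variable {V : Type*} {G : SimpleGraph V} {ι κ : Type*} (D : LeafTriangleDecomposition G ι κ)

open BlockVertex

/-- The exponent vectors of the generators of the `k`-th power of the cover ideal. -/
structure IsExponent (k : ℕ) (e : V → ℕ) : Prop where
  stem_add_leaf : ∀ i, e (D.vertex (stem i)) + e (D.vertex (leaf i)) = k
  triangle : ∀ j, e (D.vertex (apex j)) + e (D.vertex (left j)) + e (D.vertex (right j)) = 2 * k
  apex_le : ∀ j, e (D.vertex (apex j)) ≤ k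
  left_le : ∀ j, e (D.vertex (left j)) ≤ k
  right_le : ∀ j, e (D.vertex (right j)) ≤ k
  stem_add_apex : ∀ i j, G.Adj (D.vertex (stem i)) (D.vertex (apex j)) →
    k ≤ e (D.vertex (stem i)) + e (D.vertex (apex j))

lemma isVertexCover_iff (C : Set V) : G.IsVertexCover C ↔
    (∀ i, D.vertex (stem i) ∈ C ∨ D.vertex (leaf i) ∈ C) ∧
    (∀ j, D.vertex (apex j) ∈ C ∨ D.vertex (left j) ∈ C) ∧
    (∀ j, D.vertex (apex j) ∈ C ∨ D.vertex (right j) ∈ C) ∧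
    (∀ j, D.vertex (left j) ∈ C ∨ D.vertex (right j) ∈ C) ∧
    (∀ i j, G.Adj (D.vertex (stem i)) (D.vertex (apex j)) →
      D.vertex (stem i) ∈ C ∨ D.vertex (apex j) ∈ C) := by
  constructor
  · intro h
    exact ⟨fun i => h (D.adj_stem_leaf i), fun i => h (D.adj_apex_left i),
      fun i => h (D.adj_apex_right i), fun i => h (D.adj_left_right i), fun i j hij => h hij⟩
  · rintro ⟨h1, h2, h3, h4, h5⟩ x y hxy
    obtain ⟨x, rfl⟩ := D.vertex.surjective x
    obtain ⟨y, rfl⟩ := D.vertex.surjective y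
    have hc := D.compatible x y hxy
    cases x <;> cases y <;> simp only [Compatible] at hc <;> try subst hc
    · exact h1 _
    · exact h5 _ _ hxy
    · exact (h1 _).symm
    · exact (h5 _ _ hxy.symm).symm
    · exact h2 _
    · exact h3 _
    · exact (h2 _).symm
    · exact h4 _
    · exact (h3 _).symm
    · exact (h4 _).symm

lemma IsExponent.isVertexCover {e : V → ℕ} (he : D.IsExponent 1 e) :
    G.IsVertexCover {x | e x ≠ 0} := by
  rw [D.isVertexCover_iff]
  simp only [Set.mem_ofPred_eq]
  refine ⟨fun i => ?_, fun j => ?_, fun j => ?_, fun j => ?_, fun i j hij => ?_⟩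
  · have := he.stem_add_leaf i; omega
  · have := he.triangle j; have := he.right_le j; omega
  · have := he.triangle j; have := he.left_le j; omega
  · have := he.triangle j; have := he.apex_le j; omega
  · have := he.stem_add_apex i j hij; omega

lemma IsExponent.le {k : ℕ} {e : V → ℕ} (he : D.IsExponent k e) (x : V) : e x ≤ k := by
  obtain ⟨x, rfl⟩ := D.vertex.surjective x
  cases x with
  | stem i => have := he.stem_add_leaf i; omega
  | leaf i => have := he.stem_add_leaf i; omega
  | apex j => exact he.apex_le j
  | left j => exact he.left_le j
  | right j => exact he.right_le j

/-- Omitting a vertex forces all its neighbours in its block into the cover, so the block would hold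
more vertices of the support than the exact counts (one per stem–leaf edge, two per triangle) allow.
-/
lemma IsExponent.minimal_of_le {e : V → ℕ} (he : D.IsExponent 1 e) {C : Set V}
    (hC : G.IsVertexCover C) (hle : ∀ x ∈ C, e x ≠ 0) (x : V) (hx : e x ≠ 0) : x ∈ C := by
  by_contra hxC
  obtain ⟨x, rfl⟩ := D.vertex.surjective x
  cases x with
  | stem i =>
    have h1 := hle _ ((hC (D.adj_stem_leaf i)).resolve_left hxC)
    have := he.stem_add_leaf i; omega
  | leaf i =>
    have h1 := hle _ ((hC (D.adj_stem_leaf i)).resolve_right hxC)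
    have := he.stem_add_leaf i; omega
  | apex j =>
    have h1 := hle _ ((hC (D.adj_apex_left j)).resolve_left hxC)
    have h2 := hle _ ((hC (D.adj_apex_right j)).resolve_left hxC)
    have := he.triangle j; omega
  | left j =>
    have h1 := hle _ ((hC (D.adj_apex_left j)).resolve_right hxC)
    have h2 := hle _ ((hC (D.adj_left_right j)).resolve_left hxC)
    have := he.triangle j; omega
  | right j =>
    have h1 := hle _ ((hC (D.adj_apex_right j)).resolve_right hxC)
    have h2 := hle _ ((hC (D.adj_left_right j)).resolve_right hxC)
    have := he.triangle j; omega

open Classical in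
-- A leaf is redundant once its stem is present, and `left j` once `apex j` and `right j` are.
-- Minimality therefore turns the lower bounds on each block into equalities.
lemma isExponent_indicator_of_minimal {C : Finset V}
    (hC : Minimal (fun D : Finset V => G.IsVertexCover (D : Set V)) C) :
    D.IsExponent 1 (fun x => if x ∈ C then 1 else 0) := by
  have hmin : ∀ x ∈ C, ¬ G.IsVertexCover ((C.erase x : Finset V) : Set V) := by
    intro x hx h
    exact absurd (hC.2 h (Finset.erase_subset _ _) hx) (Finset.notMem_erase x C)
  obtain ⟨h1, h2, h3, h4, h5⟩ := (D.isVertexCover_iff _).1 hC.1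
  simp only [Finset.mem_coe] at h1 h2 h3 h4 h5
  have e1 : ∀ i, D.vertex (stem i) ∈ C → D.vertex (leaf i) ∉ C := by
    intro i hs hl
    apply hmin _ hl
    rw [D.isVertexCover_iff]
    simp only [Finset.mem_coe, Finset.mem_erase, ne_eq, EmbeddingLike.apply_eq_iff_eq,
      reduceCtorEq, not_false_eq_true, true_and, leaf.injEq]
    refine ⟨fun i' => ?_, h2, h3, h4, h5⟩
    by_cases hi : i' = i
    · subst hi; exact Or.inl hs
    · exact (h1 i').imp_right fun h => ⟨hi, h⟩
  have e2 : ∀ j, D.vertex (apex j) ∈ C → D.vertex (right j) ∈ C → D.vertex (left j) ∉ C := by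
    intro j ha hr hl
    apply hmin _ hl
    rw [D.isVertexCover_iff]
    simp only [Finset.mem_coe, Finset.mem_erase, ne_eq, EmbeddingLike.apply_eq_iff_eq,
      reduceCtorEq, not_false_eq_true, true_and, left.injEq]
    refine ⟨h1, fun j' => ?_, h3, fun j' => ?_, h5⟩
    · by_cases hj : j' = j
      · subst hj; exact Or.inl ha
      · exact (h2 j').imp_right fun h => ⟨hj, h⟩
    · by_cases hj : j' = j
      · subst hj; exact Or.inr hr
      · exact (h4 j').imp_left fun h => ⟨hj, h⟩
  refine ⟨fun i => ?_, fun j => ?_, fun j => ?_, fun j => ?_, fun j => ?_, fun i j hij => ?_⟩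
  · have := h1 i; have := e1 i; split_ifs <;> first | rfl | (exfalso; tauto)
  · have := h2 j; have := h3 j; have := h4 j; have := e2 j; split_ifs <;> first | rfl | (exfalso; tauto)
  · split_ifs <;> simp
  · split_ifs <;> simp
  · split_ifs <;> simp
  · have := h5 i j hij; split_ifs <;> first | (exfalso; tauto) | simp

lemma IsExponent.add {k l : ℕ} {e f : V → ℕ} (he : D.IsExponent k e) (hf : D.IsExponent l f) :
    D.IsExponent (k + l) (e + f) := by
  refine ⟨fun i => ?_, fun j => ?_, fun j => ?_, fun j => ?_, fun j => ?_, fun i j hij => ?_⟩ <;>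
    simp only [Pi.add_apply]
  · have := he.stem_add_leaf i; have := hf.stem_add_leaf i; omega
  · have := he.triangle j; have := hf.triangle j; omega
  · have := he.apex_le j; have := hf.apex_le j; omega
  · have := he.left_le j; have := hf.left_le j; omega
  · have := he.right_le j; have := hf.right_le j; omega
  · have := he.stem_add_apex i j hij; have := hf.stem_add_apex i j hij; omega

/-- A cover is split off greedily. It must contain every vertex of value `k + 1`, so that the rest
is bounded by `k`, and no vertex of value `0`. -/
lemma IsExponent.exists_eq_add {k : ℕ} {e : V → ℕ} (he : D.IsExponent (k + 1) e) :
    ∃ f g, D.IsExponent k f ∧ D.IsExponent 1 g ∧ e = f + g := by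
  classical
  let E : BlockVertex ι κ → ℕ := fun x => e (D.vertex x)
  -- Stems are used only when forced, apexes whenever possible. A stem–apex edge then loses two only
  -- if its stem retains the value `k`, and every such edge is covered since its values sum to at
  -- least `k + 1`.
  let δ : BlockVertex ι κ → ℕ
    | stem i => if E (stem i) = k + 1 then 1 else 0
    | leaf i => if E (stem i) = k + 1 then 0 else 1
    | apex j => if E (apex j) = 0 then 0 else 1
    | left j => if E (apex j) = 0 then 1 else if E (right j) = k + 1 then 0 else 1
    | right j => if E (apex j) = 0 then 1 else if E (right j) = k + 1 then 1 else 0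
  have b1 : ∀ i, E (stem i) + E (leaf i) = k + 1 := he.stem_add_leaf
  have b2 : ∀ j, E (apex j) + E (left j) + E (right j) = 2 * (k + 1) := he.triangle
  have b3 : ∀ j, E (apex j) ≤ k + 1 := he.apex_le
  have b4 : ∀ j, E (left j) ≤ k + 1 := he.left_le
  have b5 : ∀ j, E (right j) ≤ k + 1 := he.right_le
  have hle : ∀ x, δ x ≤ E x := by
    rintro (i | i | j | j | j) <;> simp only [δ]
    · split_ifs <;> omega
    · have := b1 i; split_ifs <;> omega
    · split_ifs <;> omega
    · have := b2 j; have := b3 j; have := b5 j; split_ifs <;> omega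
    · have := b2 j; have := b3 j; have := b4 j; split_ifs <;> omega
  refine ⟨fun x => E (D.vertex.symm x) - δ (D.vertex.symm x), fun x => δ (D.vertex.symm x),
    ⟨fun i => ?_, fun j => ?_, fun j => ?_, fun j => ?_, fun j => ?_, fun i j hij => ?_⟩,
    ⟨fun i => ?_, fun j => ?_, fun j => ?_, fun j => ?_, fun j => ?_, fun i j hij => ?_⟩, ?_⟩
  all_goals try simp only [Equiv.symm_apply_apply, δ]
  · have := b1 i; split_ifs <;> omega
  · have := b2 j; have := b3 j; have := b4 j; have := b5 j; split_ifs <;> omega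
  · have := b3 j; split_ifs <;> omega
  · have := b2 j; have := b4 j; split_ifs <;> omega
  · have := b2 j; have := b5 j; split_ifs <;> omega
  · have : k + 1 ≤ E (stem i) + E (apex j) := he.stem_add_apex i j hij
    split_ifs <;> omega
  · split_ifs <;> rfl
  · split_ifs <;> rfl
  · split_ifs <;> simp
  · split_ifs <;> simp
  · split_ifs <;> simp
  · have : k + 1 ≤ E (stem i) + E (apex j) := he.stem_add_apex i j hij
    have := b1 i
    split_ifs <;> omega
  · ext1 x
    obtain ⟨x, rfl⟩ := D.vertex.surjective x
    simp only [Pi.add_apply, Equiv.symm_apply_apply]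
    exact (Nat.sub_add_cancel (hle x)).symm

lemma coverIdeal_eq_span (K : Type*) [Field K] [Finite V] : coverIdeal K G =
    Ideal.span ((fun e => MvPolynomial.monomial e (1 : K)) '' {e | D.IsExponent 1 e}) := by
  classical
  cases nonempty_fintype V
  have hmon : ∀ C : Finset V, ∏ v ∈ C, (MvPolynomial.X v : MvPolynomial V K) =
      MvPolynomial.monomial (Finsupp.equivFunOnFinite.symm fun x => if x ∈ C then 1 else 0) 1 := by
    intro C
    rw [MvPolynomial.monomial_eq, MvPolynomial.C_1, one_mul, Finsupp.prod_fintype _ _ (by simp),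
      ← Finset.prod_subset (Finset.subset_univ C) (fun x _ hx => by simp [hx])]
    exact Finset.prod_congr rfl fun x hx => by simp [hx]
  rw [coverIdeal]
  congr 1
  ext f
  constructor
  · rintro ⟨C, hC, rfl⟩
    exact ⟨_, D.isExponent_indicator_of_minimal hC, (hmon C).symm⟩
  · rintro ⟨e, he, rfl⟩
    have he : D.IsExponent 1 e := he
    refine ⟨Finset.univ.filter fun x => e x ≠ 0, ⟨?_, ?_⟩, ?_⟩
    · simpa using he.isVertexCover
    · intro C hC hle x hx
      exact he.minimal_of_le D hC (fun y hy => by simpa using hle hy) x (by simpa using hx)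
    · rw [hmon]
      congr 2
      ext x
      have := he.le D x
      simp only [Finset.mem_filter, Finset.mem_univ, true_and, Finsupp.equivFunOnFinite_symm_apply_apply]
      split_ifs <;> omega

lemma coverIdeal_pow_eq_span (K : Type*) [Field K] [Finite V] (k : ℕ) : coverIdeal K G ^ k =
    Ideal.span ((fun e => MvPolynomial.monomial e (1 : K)) '' {e | D.IsExponent k e}) := by
  classical
  induction k with
  | zero =>
    rw [pow_zero, Ideal.one_eq_top, eq_comm, Ideal.eq_top_iff_one]
    refine Ideal.subset_span ⟨0, ?_, rfl⟩
    exact ⟨fun _ => rfl, fun _ => rfl, fun _ => le_rfl, fun _ => le_rfl, fun _ => le_rfl,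
      fun _ _ _ => le_rfl⟩
  | succ k ih =>
    rw [pow_succ, ih, D.coverIdeal_eq_span, Ideal.span_mul_span']
    congr 1
    ext p
    constructor
    · rintro ⟨_, ⟨e, he, rfl⟩, _, ⟨f, hf, rfl⟩, rfl⟩
      refine ⟨e + f, ?_, by simp [MvPolynomial.monomial_mul]⟩
      exact IsExponent.add D he hf
    · rintro ⟨e, he, rfl⟩
      obtain ⟨f, g, hf, hg, hfg⟩ := IsExponent.exists_eq_add D he
      refine ⟨_, ⟨Finsupp.equivFunOnFinite.symm f, hf, rfl⟩, _,
        ⟨Finsupp.equivFunOnFinite.symm g, hg, rfl⟩, ?_⟩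
      simp only [MvPolynomial.monomial_mul, mul_one]
      congr 2
      ext x
      exact (congrFun hfg x).symm

/-- The weight whose decreasing order gives linear quotients. -/
def blockWeight {ι κ : Type*} : BlockVertex ι κ → ℕ
  | stem _ | apex _ => 2
  | left _ => 1
  | leaf _ | right _ => 0

/-- The block equations determine an exponent from its coordinates of nonzero weight. If none of
these were larger in `f`, the weight inequality would make them all equal. -/
lemma IsExponent.exists_lt {k : ℕ} [Finite V] {e f : V →₀ ℕ} (he : D.IsExponent k e)
    (hf : D.IsExponent k f) (hne : e ≠ f)
    (hw : Finsupp.weight (fun x => blockWeight (D.vertex.symm x)) e ≤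
      Finsupp.weight (fun x => blockWeight (D.vertex.symm x)) f) :
    ∃ x, blockWeight x ≠ 0 ∧ e (D.vertex x) < f (D.vertex x) := by
  cases nonempty_fintype V
  by_contra! h
  apply hne
  rw [Finsupp.weight_apply, Finsupp.weight_apply, Finsupp.sum_fintype _ _ (by simp),
    Finsupp.sum_fintype _ _ (by simp)] at hw
  have hle : ∀ x ∈ Finset.univ, f x • blockWeight (D.vertex.symm x) ≤
      e x • blockWeight (D.vertex.symm x) := by
    intro x _
    obtain ⟨x, rfl⟩ := D.vertex.surjective x
    rw [Equiv.symm_apply_apply]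
    by_cases hx : blockWeight x = 0
    · simp [hx]
    · exact Nat.mul_le_mul_right _ (h x hx)
  have heq := (Finset.sum_eq_sum_iff_of_le hle).1 (le_antisymm (Finset.sum_le_sum hle) hw)
  have key : ∀ x, blockWeight x ≠ 0 → e (D.vertex x) = f (D.vertex x) := by
    intro x hx
    have := heq (D.vertex x) (Finset.mem_univ _)
    rw [Equiv.symm_apply_apply] at this
    exact (Nat.eq_of_mul_eq_mul_right (Nat.pos_of_ne_zero hx) this).symm
  ext x
  obtain ⟨x, rfl⟩ := D.vertex.surjective x
  cases x with
  | stem i => exact key _ (by simp [blockWeight])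
  | apex i => exact key _ (by simp [blockWeight])
  | left i => exact key _ (by simp [blockWeight])
  | leaf i =>
    have := key (stem i) (by simp [blockWeight])
    have := he.stem_add_leaf i
    have := hf.stem_add_leaf i
    omega
  | right j =>
    have := key (apex j) (by simp [blockWeight])
    have := key (left j) (by simp [blockWeight])
    have := he.triangle j
    have := hf.triangle j
    omega

/-- The unit is taken from the leaf for a stem, from `right` for `left`, and from `left` for an
apex. The lowered vertices do not occur in the stem–apex inequalities, so these survive. -/
lemma IsExponent.exchange {k : ℕ} {e f : V →₀ ℕ} (he : D.IsExponent k e)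
    (hf : D.IsExponent k f) {x : BlockVertex ι κ} (hx : blockWeight x ≠ 0)
    (hlt : e (D.vertex x) < f (D.vertex x)) :
    ∃ g : V →₀ ℕ, D.IsExponent k g ∧ ∃ y, blockWeight y < blockWeight x ∧
      g + Finsupp.single (D.vertex y) 1 = e + Finsupp.single (D.vertex x) 1 := by
  classical
  have hpos : ∀ y, e (D.vertex y) ≠ 0 →
      e + Finsupp.single (D.vertex x) 1 - Finsupp.single (D.vertex y) 1 +
        Finsupp.single (D.vertex y) 1 = e + Finsupp.single (D.vertex x) 1 := by
    intro y hy
    refine tsub_add_cancel_of_le (le_add_right ?_)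
    rw [Finsupp.single_le_iff]
    omega
  suffices ∃ y, blockWeight y < blockWeight x ∧ e (D.vertex y) ≠ 0 ∧
      D.IsExponent k (e + Finsupp.single (D.vertex x) 1 - Finsupp.single (D.vertex y) 1 : V →₀ ℕ) by
    obtain ⟨y, h1, h2, h3⟩ := this
    exact ⟨_, h3, y, h1, hpos y h2⟩
  have hval : ∀ y z, (e + Finsupp.single (D.vertex x) 1 - Finsupp.single (D.vertex y) 1 : V →₀ ℕ)
      (D.vertex z) = e (D.vertex z) + (if x = z then 1 else 0) - (if y = z then 1 else 0) := by
    intro y z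
    simp [Finsupp.single_apply]
  have hfx := hf.le D (D.vertex x)
  cases x with
  | leaf i => simp [blockWeight] at hx
  | right i => simp [blockWeight] at hx
  | stem i =>
    have := he.stem_add_leaf i
    refine ⟨leaf i, by simp [blockWeight], by omega, ?_⟩
    constructor <;> simp only [hval, reduceCtorEq, if_false, stem.injEq, leaf.injEq, add_zero, tsub_zero]
    · intro i'
      have := he.stem_add_leaf i'
      split_ifs with h
      · subst h; omega
      · omega
    · exact he.triangle
    · exact he.apex_le
    · exact he.left_le
    · exact he.right_le
    · intro i' j hij
      have := he.stem_add_apex i' j hij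
      omega
  | left j =>
    have := he.triangle j
    have := he.apex_le j
    refine ⟨right j, by simp [blockWeight], by omega, ?_⟩
    constructor <;> simp only [hval, reduceCtorEq, if_false, left.injEq, right.injEq, add_zero, tsub_zero]
    · exact he.stem_add_leaf
    · intro j'
      have := he.triangle j'
      split_ifs with h
      · subst h; omega
      · omega
    · exact he.apex_le
    · intro j'
      have := he.left_le j'
      split_ifs with h
      · subst h; omega
      · omega
    · intro j'
      have := he.right_le j'
      split_ifs <;> omega
    · exact he.stem_add_apex
  | apex j =>
    have := he.triangle j
    -- If `left j` had value `0`, the triangle sum `2 * k` would force the apex to be `k` already,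
    -- leaving no room to grow.
    by_cases hl : e (D.vertex (left j)) = 0
    · have := he.right_le j
      omega
    refine ⟨left j, by simp [blockWeight], hl, ?_⟩
    constructor <;> simp only [hval, reduceCtorEq, if_false, left.injEq, apex.injEq, add_zero, tsub_zero]
    · exact he.stem_add_leaf
    · intro j'
      have := he.triangle j'
      split_ifs with h
      · subst h; omega
      · omega
    · intro j'
      have := he.apex_le j'
      split_ifs with h
      · subst h; omega
      · omega
    · intro j'
      have := he.left_le j'
      split_ifs <;> omega
    · exact he.right_le
    · intro i j' hij
      have := he.stem_add_apex i j' hij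
      omega

/-- `BlockVertex ι κ` as an iterated sum type. -/
def blockVertexEquiv (ι κ : Type*) : (ι ⊕ ι) ⊕ (κ ⊕ κ) ⊕ κ ≃ BlockVertex ι κ where
  toFun
    | .inl (.inl i) => stem i
    | .inl (.inr i) => leaf i
    | .inr (.inl (.inl j)) => apex j
    | .inr (.inl (.inr j)) => left j
    | .inr (.inr j) => right j
  invFun
    | stem i => .inl (.inl i)
    | leaf i => .inl (.inr i)
    | apex j => .inr (.inl (.inl j))
    | left j => .inr (.inl (.inr j))
    | right j => .inr (.inr j)
  left_inv := by rintro ((_ | _) | (_ | _) | _) <;> rfl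
  right_inv := by rintro (_ | _ | _ | _ | _) <;> rfl

lemma IsExponent.degree_eq [Finite V] [Fintype ι] [Fintype κ] {k : ℕ} {e : V →₀ ℕ}
    (he : D.IsExponent k e) :
    e.degree = Fintype.card ι * k + Fintype.card κ * (2 * k) := by
  cases nonempty_fintype V
  rw [Finsupp.degree_eq_sum, ← Equiv.sum_comp ((blockVertexEquiv ι κ).trans D.vertex)]
  simp only [Fintype.sum_sum_type, ← Finset.sum_add_distrib]
  congr 1
  · exact (Finset.sum_congr rfl fun i _ => he.stem_add_leaf i).trans (by simp)
  · exact (Finset.sum_congr rfl fun j _ => he.triangle j).trans (by simp)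

theorem hasLinearResolution_coverIdeal_pow (D : LeafTriangleDecomposition G ι κ) (K : Type*) [Field K] [Finite V] (k : ℕ) :
    HasLinearResolution (coverIdeal K G ^ k) := by
  classical
  have hι : Finite ι := Finite.of_injective (fun i => D.vertex (stem i)) fun i i' h => by
    simpa using h
  have hκ : Finite κ := Finite.of_injective (fun i => D.vertex (apex i)) fun i i' h => by
    simpa using h
  cases nonempty_fintype ι
  cases nonempty_fintype κ
  rw [D.coverIdeal_pow_eq_span]
  have hfin : {e : V →₀ ℕ | D.IsExponent k e}.Finite :=
    (Finsupp.finite_of_degree_le (Fintype.card ι * k + Fintype.card κ * (2 * k))).subset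
      fun e he => (IsExponent.degree_eq D he).le
  have := hasLinearResolutionOfDegree_of_linear_quotients (K := K)
    (Fintype.card ι * k + Fintype.card κ * (2 * k))
    (Finsupp.weight (fun x => blockWeight (D.vertex.symm x))) hfin.toFinset
    (fun e he => IsExponent.degree_eq D (by simpa using he)) (by
      intro e he f hf hne hw
      rw [Set.Finite.mem_toFinset] at he hf
      obtain ⟨x, hx, hlt⟩ := IsExponent.exists_lt D he hf hne hw
      obtain ⟨g, hg, y, hy, hgy⟩ := IsExponent.exchange D he hf hx hlt
      refine ⟨g, by simpa using hg, ?_, D.vertex x, hlt, hgy ▸ le_self_add⟩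
      have := congrArg (Finsupp.weight (fun x => blockWeight (D.vertex.symm x))) hgy
      simp only [map_add, Finsupp.weight_single, Equiv.symm_apply_apply, one_smul] at this
      omega)
  rw [Set.Finite.coe_toFinset] at this
  exact this.hasLinearResolution

end LeafTriangleDecomposition

end LeafTriangle

/-! ### Depth is bounded by the dimension of `R ⧸ p` for associated primes `p`. -/

section Depth

open RingTheory.Sequence
open scoped Pointwise

/-- Let `N` be the submodule killed by `p`. If `N ⊆ xM`, regularity of `x` gives `N = xN`, so `N =
0` by Nakayama, a contradiction. An element of `N` outside `xM` has a nonzero class killed by `p`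
and `x`, and its annihilator lies in an associated prime. -/
lemma exists_isAssociatedPrime_quotSMulTop {R M : Type*} [CommRing R] [IsNoetherianRing R]
    [IsLocalRing R] [AddCommGroup M] [Module R M] [Module.Finite R M] {x : R}
    (hx : x ∈ IsLocalRing.maximalIdeal R) (hreg : IsSMulRegular M x) {p : Ideal R}
    (hp : IsAssociatedPrime p M) :
    ∃ q : Ideal R, IsAssociatedPrime q (QuotSMulTop x M) ∧ p ≤ q ∧ x ∈ q := by
  obtain ⟨hpp, m, hm⟩ := isAssociatedPrime_iff.1 hp
  have hm0 : m ≠ 0 := by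
    rintro rfl
    apply hpp.ne_top
    rw [hm, Ideal.eq_top_iff_one, Submodule.mem_colon_singleton, smul_zero]
    exact Submodule.zero_mem _
  let N : Submodule R M :=
    { carrier := {n | ∀ r ∈ p, r • n = 0}
      add_mem' := fun {a b} ha hb r hr => by rw [smul_add, ha r hr, hb r hr, add_zero]
      zero_mem' := fun r _ => smul_zero r
      smul_mem' := fun c a ha r hr => by rw [smul_comm, ha r hr, smul_zero] }
  have hmN : m ∈ N := by
    intro r hr
    rw [hm, Submodule.mem_colon_singleton, Submodule.mem_bot] at hr
    exact hr
  obtain ⟨n, hn, hnx⟩ : ∃ n ∈ N, n ∉ x • (⊤ : Submodule R M) := by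
    by_contra! hcon
    have hle : N ≤ Ideal.span {x} • N := by
      intro n hn
      obtain ⟨n', -, rfl⟩ := (Submodule.mem_smul_pointwise_iff_exists _ _ _).1 (hcon n hn)
      refine Submodule.smul_mem_smul (Ideal.mem_span_singleton_self x) fun r hr => hreg ?_
      change x • r • n' = x • 0
      rw [smul_zero, smul_comm]
      exact hn r hr
    have := Submodule.eq_bot_of_le_smul_of_le_jacobson_bot _ N (IsNoetherian.noetherian N) hle
      (by
        rw [IsLocalRing.jacobson_eq_maximalIdeal _ bot_ne_top, Ideal.span_singleton_le_iff_mem]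
        exact hx)
    exact hm0 ((Submodule.mem_bot R).1 (this ▸ hmN))
  obtain ⟨q, hq, hle⟩ := exists_le_isAssociatedPrime_of_isNoetherianRing R
    (Submodule.Quotient.mk n : QuotSMulTop x M)
    (by rwa [ne_eq, Submodule.Quotient.mk_eq_zero])
  refine ⟨q, hq, fun r hr => hle ?_, hle ?_⟩
  · rw [Submodule.mem_colon_singleton, Submodule.mem_bot, ← Submodule.Quotient.mk_smul, hn r hr,
      Submodule.Quotient.mk_zero]
  · rw [Submodule.mem_colon_singleton, Submodule.mem_bot, ← Submodule.Quotient.mk_smul,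
      Submodule.Quotient.mk_eq_zero]
    exact Submodule.smul_mem_pointwise_smul _ _ _ trivial

/-- The length of a regular sequence on `M` is at most `dim R ⧸ p` for each associated prime `p`
of `M`. -/
lemma length_le_ringKrullDim_quotient {R : Type*} [CommRing R] [IsNoetherianRing R]
    [IsLocalRing R] (rs : List R) :
    ∀ {M : Type*} [AddCommGroup M] [Module R M] [Module.Finite R M],
      IsWeaklyRegular M rs → (∀ r ∈ rs, r ∈ IsLocalRing.maximalIdeal R) →
      ∀ {p : Ideal R}, IsAssociatedPrime p M → (rs.length : WithBot ℕ∞) ≤ ringKrullDim (R ⧸ p) := by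
  induction rs with
  | nil =>
    intro M _ _ _ _ _ p hp
    have := hp.isPrime
    have : Nontrivial (R ⧸ p) := Ideal.Quotient.nontrivial_iff.2 hp.isPrime.ne_top
    simpa using ringKrullDim_nonneg_of_nontrivial
  | cons x rs ih =>
    intro M _ _ _ hreg hmem p hp
    rw [isWeaklyRegular_cons_iff] at hreg
    obtain ⟨q, hq, hpq, hxq⟩ := exists_isAssociatedPrime_quotSMulTop
      (hmem x List.mem_cons_self) hreg.1 hp
    have h1 := ih hreg.2 (fun r hr => hmem r (List.mem_cons_of_mem _ hr)) hq
    -- Since `x` is a nonzerodivisor on `M`, it lies in `q` but not in `p`, so the dimension drops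
    -- by at least one.
    have hxp : x ∉ p := by
      intro hxp
      obtain ⟨hpp, m, hm⟩ := isAssociatedPrime_iff.1 hp
      apply hpp.ne_top
      rw [hm, Submodule.mem_colon_singleton, Submodule.mem_bot] at hxp
      have hm0 : m = 0 := hreg.1 (by simpa using hxp)
      rw [hm, Ideal.eq_top_iff_one, Submodule.mem_colon_singleton, hm0, smul_zero]
      exact Submodule.zero_mem _
    have := hp.isPrime
    have h2 := ringKrullDim_succ_le_of_surjective (Ideal.Quotient.factor hpq)
      (Ideal.Quotient.factor_surjective hpq) (r := Ideal.Quotient.mk p x)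
      (mem_nonZeroDivisors_of_ne_zero (by rwa [ne_eq, Ideal.Quotient.eq_zero_iff_mem]))
      (by rw [Ideal.Quotient.factor_mk, Ideal.Quotient.eq_zero_iff_mem]; exact hxq)
    refine le_trans ?_ h2
    rw [List.length_cons, Nat.cast_add, Nat.cast_one]
    gcongr

lemma localDepth_le_ringKrullDim_quotient {R : Type*} [CommRing R] [IsNoetherianRing R]
    [IsLocalRing R] {p : Ideal R} (hp : IsAssociatedPrime p R) :
    (localDepth R : WithBot ℕ∞) ≤ ringKrullDim (R ⧸ p) := by
  have hpp := hp.isPrime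
  have : Nontrivial (R ⧸ p) := Ideal.Quotient.nontrivial_iff.2 hpp.ne_top
  obtain ⟨n, hn⟩ : ∃ n : ℕ∞, ringKrullDim (R ⧸ p) = n :=
    (WithBot.ne_bot_iff_exists.1 (ne_bot_of_le_ne_bot WithBot.zero_ne_bot
      ringKrullDim_nonneg_of_nontrivial)).imp fun _ h => h.symm
  rw [hn, WithBot.coe_le_coe]
  refine iSup₂_le fun rs hrs => ?_
  have := length_le_ringKrullDim_quotient rs hrs.1.toIsWeaklyRegular hrs.2 hp
  rw [hn] at this
  exact_mod_cast this

end Depth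

/-! ### Cohen–Macaulay graphs are unmixed. -/

section Unmixed

open MvPolynomial

variable (K : Type*) [Field K] {V : Type*} (G : SimpleGraph V)

open Classical in
/-- The evaluation of the edge ring at `0` on the vertices of a vertex cover. -/
noncomputable def edgeRingEval {C : Set V} (hC : G.IsVertexCover C) :
    MvPolynomial V K ⧸ edgeIdeal K G →+* MvPolynomial V K :=
  Ideal.Quotient.lift _ (aeval fun v => if v ∈ C then 0 else X v : _ →ₐ[K] MvPolynomial V K).toRingHom
    (by
      intro f hf
      suffices edgeIdeal K G ≤ RingHom.ker (aeval fun v => if v ∈ C then 0 else X v :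
          MvPolynomial V K →ₐ[K] MvPolynomial V K).toRingHom from this hf
      rw [edgeIdeal, Ideal.span_le]
      rintro _ ⟨v, w, hvw, rfl⟩
      rcases hC hvw with h | h <;> simp [RingHom.mem_ker, h])

open Classical in
lemma edgeRingEval_mk {C : Set V} (hC : G.IsVertexCover C) (f : MvPolynomial V K) :
    edgeRingEval K G hC (Ideal.Quotient.mk _ f) = aeval (fun v => if v ∈ C then 0 else X v) f := rfl

/-- The constant coefficient on the edge ring. -/
noncomputable def edgeRingConstantCoeff : MvPolynomial V K ⧸ edgeIdeal K G →+* K :=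
  Ideal.Quotient.lift _ constantCoeff (by
    intro f hf
    suffices edgeIdeal K G ≤ RingHom.ker constantCoeff from this hf
    rw [edgeIdeal, Ideal.span_le]
    rintro _ ⟨v, w, hvw, rfl⟩
    simp [RingHom.mem_ker])

lemma edgeRingConstantCoeff_mk (f : MvPolynomial V K) :
    edgeRingConstantCoeff K G (Ideal.Quotient.mk _ f) = constantCoeff f := rfl

instance : (RingHom.ker (edgeRingConstantCoeff K G)).IsMaximal :=
  RingHom.ker_isMaximal_of_surjective _ fun c => ⟨Ideal.Quotient.mk _ (C c), by
    simp [edgeRingConstantCoeff_mk]⟩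

lemma ker_edgeRingEval_le {C : Set V} (hC : G.IsVertexCover C) :
    RingHom.ker (edgeRingEval K G hC) ≤ RingHom.ker (edgeRingConstantCoeff K G) := by
  classical
  have : (edgeRingConstantCoeff K G) = (constantCoeff).comp (edgeRingEval K G hC) := by
    apply Ideal.Quotient.ringHom_ext
    apply MvPolynomial.ringHom_ext
    · intro c
      simp [edgeRingConstantCoeff_mk, edgeRingEval_mk]
    · intro v
      simp only [RingHom.comp_apply, edgeRingEval_mk, aeval_X]
      split_ifs <;> simp [edgeRingConstantCoeff_mk]
  intro f hf
  rw [RingHom.mem_ker] at hf ⊢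
  rw [this, RingHom.comp_apply, hf, map_zero]

lemma ker_edgeRingEval_mono {C D : Set V} (hC : G.IsVertexCover C) (hD : G.IsVertexCover D)
    (h : C ⊆ D) : RingHom.ker (edgeRingEval K G hC) ≤ RingHom.ker (edgeRingEval K G hD) := by
  classical
  have : edgeRingEval K G hD = (aeval fun v => if v ∈ D then 0 else X v :
      MvPolynomial V K →ₐ[K] MvPolynomial V K).toRingHom.comp (edgeRingEval K G hC) := by
    apply Ideal.Quotient.ringHom_ext
    apply MvPolynomial.ringHom_ext
    · intro c
      simp [edgeRingEval_mk]
    · intro v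
      simp only [RingHom.comp_apply, edgeRingEval_mk, aeval_X]
      by_cases hv : v ∈ C
      · simp [hv, h hv]
      · simp [hv]
  intro f hf
  rw [RingHom.mem_ker] at hf ⊢
  rw [this, RingHom.comp_apply, hf, map_zero]

lemma mk_X_mem_ker_edgeRingEval {C : Set V} (hC : G.IsVertexCover C) (v : V) :
    Ideal.Quotient.mk _ (X v) ∈ RingHom.ker (edgeRingEval K G hC) ↔ v ∈ C := by
  classical
  rw [RingHom.mem_ker, edgeRingEval_mk, aeval_X]
  split_ifs with h <;> simp [h, X_ne_zero]

/-- Enlarging the cover one vertex at a time gives a strict chain of evaluation kernels, all prime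
and all inside the ideal of the origin. -/
lemma card_sub_card_le_height [Fintype V] {C : Finset V} (hC : G.IsVertexCover (C : Set V)) :
    ((Fintype.card V - C.card : ℕ) : ℕ∞) ≤ (RingHom.ker (edgeRingConstantCoeff K G)).height := by
  classical
  have key : ∀ D : Finset V, Disjoint C D → ∀ h : G.IsVertexCover ((C ∪ D : Finset V) : Set V),
      (D.card : ℕ∞) ≤ (RingHom.ker (edgeRingEval K G h)).height := by
    intro D
    induction D using Finset.induction_on with
    | empty => intro _ _; simp
    | insert x D hx ih =>
      intro hdisj h
      rw [Finset.disjoint_insert_right] at hdisj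
      have h' : G.IsVertexCover ((C ∪ D : Finset V) : Set V) :=
        hC.subset (by simp)
      have hlt : RingHom.ker (edgeRingEval K G h') < RingHom.ker (edgeRingEval K G h) := by
        refine lt_of_le_of_ne (ker_edgeRingEval_mono K G h' h ?_) fun heq => ?_
        · rw [Finset.coe_subset]
          exact Finset.union_subset_union_right (Finset.subset_insert _ _)
        · have := (mk_X_mem_ker_edgeRingEval K G h x).2 (by simp)
          rw [← heq, mk_X_mem_ker_edgeRingEval] at this
          simp [hx, hdisj.1] at this
      have := RingHom.ker_isPrime (edgeRingEval K G h')
      have := RingHom.ker_isPrime (edgeRingEval K G h)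
      rw [Finset.card_insert_of_notMem hx, Nat.cast_add, Nat.cast_one]
      exact (add_le_add_left (ih hdisj.2 h') 1).trans
        (Ideal.height_add_one_le_of_lt_of_isPrime hlt)
  have hu : G.IsVertexCover ((C ∪ Cᶜ : Finset V) : Set V) := hC.subset (by simp)
  rw [← Finset.card_compl]
  exact (key Cᶜ disjoint_compl_right hu).trans (Ideal.height_mono (ker_edgeRingEval_le K G hu))

lemma ker_edgeRingConstantCoeff_eq_span : RingHom.ker (edgeRingConstantCoeff K G) =
    Ideal.span (Set.range fun v => Ideal.Quotient.mk (edgeIdeal K G) (X v)) := by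
  apply le_antisymm
  · intro f hf
    obtain ⟨f, rfl⟩ := Ideal.Quotient.mk_surjective f
    have hf : constantCoeff f = 0 := hf
    have : f ∈ Ideal.span (X '' (Set.univ : Set V)) := by
      rw [mem_ideal_span_X_image]
      intro m hm
      by_contra! h
      have : m = 0 := by ext i; exact h i trivial
      rw [mem_support_iff, this] at hm
      exact hm hf
    have := Ideal.mem_map_of_mem (Ideal.Quotient.mk (edgeIdeal K G)) this
    rwa [Ideal.map_span, Set.image_univ, ← Set.range_comp] at this
  · rw [Ideal.span_le]
    rintro _ ⟨v, rfl⟩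
    simp [edgeRingConstantCoeff_mk, RingHom.mem_ker]

/-- The variables in `C` vanish modulo `q`, so the others generate the maximal ideal, and Krull's
height theorem bounds the dimension by their number. -/
lemma ringKrullDim_quotient_le_card [Fintype V] {R : Type*} [CommRing R] [IsLocalRing R]
    [IsNoetherianRing R] (C : Finset V) (x : V → R)
    (hx : IsLocalRing.maximalIdeal R = Ideal.span (Set.range x)) {q : Ideal R} (hq : q ≠ ⊤)
    (hqC : ∀ v ∈ C, x v ∈ q) : ringKrullDim (R ⧸ q) ≤ (Fintype.card V - C.card : ℕ) := by
  classical
  have : Nontrivial (R ⧸ q) := Ideal.Quotient.nontrivial_iff.2 hq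
  have : IsLocalRing (R ⧸ q) := .of_surjective' (Ideal.Quotient.mk q) Ideal.Quotient.mk_surjective
  have hmax : IsLocalRing.maximalIdeal (R ⧸ q) ≤
      Ideal.span (((Cᶜ : Finset V).image fun v => Ideal.Quotient.mk q (x v) : Finset (R ⧸ q)) : Set (R ⧸ q)) := by
    intro y hy
    obtain ⟨y, rfl⟩ := Ideal.Quotient.mk_surjective y
    have hy' : y ∈ IsLocalRing.maximalIdeal R := by
      rw [IsLocalRing.mem_maximalIdeal] at hy ⊢
      exact fun h => hy (h.map _)
    rw [hx] at hy'
    have := Ideal.mem_map_of_mem (Ideal.Quotient.mk q) hy'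
    rw [Ideal.map_span, ← Set.range_comp] at this
    refine (Ideal.span_le.2 ?_) this
    rintro _ ⟨v, rfl⟩
    by_cases hv : v ∈ C
    · have : Ideal.Quotient.mk q (x v) = 0 := Ideal.Quotient.eq_zero_iff_mem.2 (hqC v hv)
      simp [this]
    · apply Ideal.subset_span
      rw [Finset.coe_image]
      exact ⟨v, by simpa using hv, rfl⟩
  have hmax' : Ideal.span (((Cᶜ : Finset V).image fun v => Ideal.Quotient.mk q (x v) : Finset (R ⧸ q)) : Set (R ⧸ q)) ≤
      IsLocalRing.maximalIdeal (R ⧸ q) := by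
    rw [Ideal.span_le]
    intro y hy
    rw [Finset.coe_image] at hy
    obtain ⟨v, -, rfl⟩ := hy
    have hv : x v ∈ IsLocalRing.maximalIdeal R := hx ▸ Ideal.subset_span ⟨v, rfl⟩
    rw [SetLike.mem_coe, IsLocalRing.mem_maximalIdeal]
    intro hu
    obtain ⟨y, hy⟩ := hu.exists_right_inv
    obtain ⟨y, rfl⟩ := Ideal.Quotient.mk_surjective y
    rw [← map_mul, ← map_one (Ideal.Quotient.mk q), Ideal.Quotient.eq] at hy
    have h1 := Ideal.sub_mem _ (Ideal.mul_mem_right y _ hv) (IsLocalRing.le_maximalIdeal hq hy)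
    rw [sub_sub_cancel] at h1
    exact Ideal.IsPrime.ne_top' (Ideal.eq_top_of_isUnit_mem _ h1 isUnit_one)
  refine (ringKrullDim_le_spanFinrank_maximalIdeal (R ⧸ q)).trans ?_
  rw [le_antisymm hmax hmax', Nat.cast_le]
  refine (Submodule.spanFinrank_span_le_ncard_of_finite (Finset.finite_toSet _)).trans ?_
  rw [Set.ncard_coe_finset, ← Finset.card_compl]
  exact Finset.card_image_le

/-- In a Cohen–Macaulay graph every minimal vertex cover has the smallest possible size. -/
theorem IsCohenMacaulayGraph.card_le_card [Fintype V] (hCM : IsCohenMacaulayGraph K G)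
    {C D : Finset V} (hC : Minimal (fun D : Finset V => G.IsVertexCover (D : Set V)) C)
    (hD : G.IsVertexCover (D : Set V)) : C.card ≤ D.card := by
  classical
  let A := MvPolynomial V K ⧸ edgeIdeal K G
  let p : Ideal A := RingHom.ker (edgeRingConstantCoeff K G)
  let R := Localization.AtPrime p
  let x : V → R := fun v => algebraMap A R (Ideal.Quotient.mk _ (X v))
  have hmax : IsLocalRing.maximalIdeal R = Ideal.span (Set.range x) := by
    rw [← Localization.AtPrime.map_eq_maximalIdeal]
    change Ideal.map _ (RingHom.ker (edgeRingConstantCoeff K G)) = _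
    rw [ker_edgeRingConstantCoeff_eq_span, Ideal.map_span, ← Set.range_comp]
    rfl
  -- By minimality each `v ∈ C` has a neighbour outside `C`, so `x_v` kills this product. The
  -- product stays nonzero in the localization because it is nonzero after evaluating `C` at `0`.
  let f : A := ∏ v ∈ Cᶜ, Ideal.Quotient.mk _ (X v)
  have hf : algebraMap A R f ≠ 0 := by
    intro h
    obtain ⟨⟨s, hs⟩, hsf⟩ := (IsLocalization.map_eq_zero_iff p.primeCompl R f).1 h
    have hmem : s * f ∈ RingHom.ker (edgeRingEval K G hC.1) := by
      have : s * f = 0 := hsf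
      rw [this]; exact Ideal.zero_mem _
    have hprime : (RingHom.ker (edgeRingEval K G hC.1)).IsPrime := RingHom.ker_isPrime _
    rcases hprime.mem_or_mem hmem with h1 | h1
    · exact hs (ker_edgeRingEval_le K G hC.1 h1)
    · obtain ⟨v, hv, h2⟩ := (hprime.prod_mem_iff).1 h1
      rw [mk_X_mem_ker_edgeRingEval] at h2
      exact (Finset.mem_compl.1 hv) h2
  obtain ⟨q, hq, hle⟩ := exists_le_isAssociatedPrime_of_isNoetherianRing R (algebraMap A R f) hf
  have hqC : ∀ v ∈ C, x v ∈ q := by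
    intro v hv
    apply hle
    rw [Submodule.mem_colon_singleton, Submodule.mem_bot, smul_eq_mul, ← map_mul]
    obtain ⟨w, hvw, hw⟩ : ∃ w, G.Adj v w ∧ w ∉ C := by
      by_contra! hcon
      refine absurd (hC.2 (y := C.erase v) ?_ (Finset.erase_subset _ _) hv) (Finset.notMem_erase _ _)
      intro a b hab
      simp only [Finset.mem_coe, Finset.mem_erase]
      by_cases ha : a = v
      · subst ha
        exact Or.inr ⟨hab.ne', hcon b hab⟩
      · by_cases hb : b = v
        · subst hb
          exact Or.inl ⟨ha, hcon a hab.symm⟩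
        · exact (hC.1 hab).imp (fun h => ⟨ha, h⟩) fun h => ⟨hb, h⟩
    have : Ideal.Quotient.mk (edgeIdeal K G) (X v) * f = 0 := by
      have hmem : (X v * X w : MvPolynomial V K) ∈ edgeIdeal K G :=
        Ideal.subset_span ⟨v, w, hvw, rfl⟩
      change _ * ∏ v ∈ Cᶜ, Ideal.Quotient.mk (edgeIdeal K G) (X v) = 0
      rw [← Finset.mul_prod_erase Cᶜ _ (Finset.mem_compl.2 hw), ← mul_assoc, ← map_mul,
        Ideal.Quotient.eq_zero_iff_mem.2 hmem, zero_mul]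
    rw [this, map_zero]
  -- With `n` vertices, `n - |D| ≤ dim R = depth R ≤ dim R ⧸ q ≤ n - |C|`.
  have h1 := localDepth_le_ringKrullDim_quotient (R := R) hq
  rw [hCM.depth_eq_dim p] at h1
  have h2 := h1.trans (ringKrullDim_quotient_le_card C x hmax hq.isPrime.ne_top hqC)
  rw [IsLocalization.AtPrime.ringKrullDim_eq_height p] at h2
  have h3 : ((Fintype.card V - D.card : ℕ) : WithBot ℕ∞) ≤ (Fintype.card V - C.card : ℕ) :=
    (WithBot.coe_le_coe.2 (card_sub_card_le_height K G hD)).trans h2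
  have h4 : Fintype.card V - D.card ≤ Fintype.card V - C.card := Nat.cast_le.1 h3
  have := Finset.card_le_univ C
  have := Finset.card_le_univ D
  omega

end Unmixed

/-! ### From matchings and unmixedness to the leaf–triangle decomposition. -/

section Matchings

variable {V : Type*} {G : SimpleGraph V}

lemma bddAbove_matching_ncard [Finite V] (P : G.Subgraph → Prop) :
    BddAbove {n | ∃ M : G.Subgraph, P M ∧ M.edgeSet.ncard = n} := by
  refine ⟨Nat.card (Sym2 V), ?_⟩
  rintro _ ⟨M, -, rfl⟩
  exact Set.ncard_le_card _

lemma exists_isMatching_insert [Finite V] {M : G.Subgraph} (hM : M.IsMatching) {a b : V}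
    (hab : G.Adj a b) (ha : a ∉ M.verts) (hb : b ∉ M.verts) :
    ∃ M' : G.Subgraph, M'.IsMatching ∧ M'.verts = M.verts ∪ {a, b} ∧
      M'.edgeSet.ncard = M.edgeSet.ncard + 1 := by
  refine ⟨M ⊔ G.subgraphOfAdj hab, hM.sup (.subgraphOfAdj hab) ?_, by simp, ?_⟩
  · rw [hM.support_eq_verts, SimpleGraph.support_subgraphOfAdj, Set.disjoint_right]
    rintro x (rfl | rfl)
    · exact ha
    · exact hb
  · rw [SimpleGraph.Subgraph.edgeSet_sup, SimpleGraph.edgeSet_subgraphOfAdj, Set.union_singleton,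
      Set.ncard_insert_of_notMem]
    intro h
    exact ha (M.edge_vert (SimpleGraph.Subgraph.mem_edgeSet.1 h))

lemma isMatching_deleteVerts {M : G.Subgraph} (hM : M.IsMatching) {a b : V} (hab : M.Adj a b) :
    (M.deleteVerts {a, b}).IsMatching := by
  rintro v ⟨hv, hvab⟩
  simp only [Set.mem_insert_iff, Set.mem_singleton_iff, not_or] at hvab
  obtain ⟨w, hw, huniq⟩ := hM hv
  refine ⟨w, ?_, fun y hy => huniq y (SimpleGraph.Subgraph.deleteVerts_adj.1 hy).2.2.2.2⟩
  refine SimpleGraph.Subgraph.deleteVerts_adj.2 ?_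
  refine ⟨hv, by simp [hvab], M.edge_vert hw.symm, ?_, hw⟩
  simp only [Set.mem_insert_iff, Set.mem_singleton_iff, not_or]
  constructor
  · rintro rfl
    exact hvab.2 (hM.eq_of_adj_left hw.symm hab)
  · rintro rfl
    exact hvab.1 (hM.eq_of_adj_right hw hab)

/-- The structure given by an induced matching of `G` that is a largest matching: `U` is the set
of the vertices outside the matching, and `τ` exchanges the ends of the edges of the matching. -/
structure IsMatchingStructure (G : SimpleGraph V) (U : Set V) (τ : V → V) : Prop where
  notMem : ∀ x ∉ U, τ x ∉ U
  invol : ∀ x ∉ U, τ (τ x) = x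
  adj : ∀ x ∉ U, G.Adj x (τ x)
  induced : ∀ x ∉ U, ∀ y ∉ U, G.Adj x y → y = τ x
  indep : ∀ x ∈ U, ∀ y ∈ U, ¬ G.Adj x y
  unique : ∀ x ∉ U, ∀ u ∈ U, ∀ u' ∈ U, G.Adj u x → G.Adj u' (τ x) → u = u'

lemma exists_isMatchingStructure [Finite V]
    (h : inducedMatchingNumber G = matchingNumber G) : ∃ U τ, IsMatchingStructure G U τ := by
  classical
  obtain ⟨M, hM, hind, hcard⟩ : inducedMatchingNumber G ∈
      {n | ∃ M : G.Subgraph, M.IsMatching ∧ M.IsInduced ∧ M.edgeSet.ncard = n} := by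
    apply Nat.sSup_mem
    · exact ⟨_, ⊥, fun v hv => hv.elim, fun v hv => hv.elim, rfl⟩
    · simpa only [and_assoc] using
        bddAbove_matching_ncard (fun M : G.Subgraph => M.IsMatching ∧ M.IsInduced)
  have hmax : ∀ M' : G.Subgraph, M'.IsMatching → M'.edgeSet.ncard ≤ M.edgeSet.ncard := by
    intro M' hM'
    rw [hcard, h]
    exact le_csSup (bddAbove_matching_ncard _) ⟨M', hM', rfl⟩
  choose! τ hτ using fun v hv => (hM (v := v) hv).exists
  have hadj : ∀ x ∉ M.vertsᶜ, M.Adj x (τ x) := fun x hx => hτ x (not_not.1 hx)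
  have hτU : ∀ x ∉ M.vertsᶜ, τ x ∉ M.vertsᶜ := fun x hx h' => h' (M.edge_vert (hadj x hx).symm)
  refine ⟨M.vertsᶜ, τ, hτU, fun x hx => ?_, fun x hx => (hadj x hx).adj_sub, fun x hx y hy hxy => ?_,
    fun x hx y hy hxy => ?_, fun x hx u hu u' hu' hux hu'x => ?_⟩
  · exact hM.eq_of_adj_left (hadj _ (hτU x hx)) (hadj x hx).symm
  · exact hM.eq_of_adj_left (hind (not_not.1 hx) (not_not.1 hy) hxy) (hadj x hx)
  · obtain ⟨M', hM', -, h'⟩ := exists_isMatching_insert hM hxy hx hy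
    have := hmax M' hM'
    omega
  -- Replacing the edge `{x, τ x}` by `{u, x}` and `{u', τ x}` would enlarge a largest matching.
  · by_contra hne
    have hM₀ := isMatching_deleteVerts hM (hadj x hx)
    obtain ⟨M₁, hM₁, hv₁, hc₁⟩ := exists_isMatching_insert hM₀ hux (fun h' => hu h'.1)
      (fun h' => h'.2 (by simp))
    have hxu : τ x ≠ u := by rintro rfl; exact hτU x hx hu
    have hxu' : u' ≠ x := by rintro rfl; exact hx hu'
    obtain ⟨M₂, hM₂, -, hc₂⟩ := exists_isMatching_insert hM₁ hu'x
      (by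
        rw [hv₁]
        rintro (h' | rfl | h')
        · exact hu' h'.1
        · exact hne rfl
        · exact hxu' h')
      (by
        rw [hv₁]
        rintro (h' | h' | h')
        · exact h'.2 (by simp)
        · exact hxu h'
        · exact (hadj x hx).ne h'.symm)
    have hle : M.edgeSet ⊆ insert s(x, τ x) (M.deleteVerts {x, τ x}).edgeSet := by
      intro e
      induction e using Sym2.ind with
      | _ a b =>
        intro hab
        rw [SimpleGraph.Subgraph.mem_edgeSet] at hab
        by_cases ha : a = x
        · subst ha
          exact Or.inl (by rw [hM.eq_of_adj_left hab (hadj _ hx)])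
        by_cases hb : b = x
        · subst hb
          exact Or.inl (by rw [hM.eq_of_adj_left hab.symm (hadj _ hx), Sym2.eq_swap])
        right
        rw [SimpleGraph.Subgraph.mem_edgeSet, SimpleGraph.Subgraph.deleteVerts_adj]
        refine ⟨M.edge_vert hab, ?_, M.edge_vert hab.symm, ?_, hab⟩
        · rintro (h' | rfl)
          · exact ha h'
          · exact hb (hM.eq_of_adj_left hab (hadj x hx).symm)
        · rintro (h' | rfl)
          · exact hb h'
          · exact ha (hM.eq_of_adj_left hab.symm (hadj x hx).symm)
    have h1 := Set.ncard_le_ncard hle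
    have h2 := Set.ncard_insert_le s(x, τ x) (M.deleteVerts {x, τ x}).edgeSet
    have := hmax M₂ hM₂
    omega

lemma mem_of_adj_closed (hG : G.Connected) {S : Set V} {x : V} (hx : x ∈ S)
    (hS : ∀ a ∈ S, ∀ b, G.Adj a b → b ∈ S) (y : V) : y ∈ S := by
  obtain ⟨p⟩ := hG.preconnected x y
  induction p with
  | nil => exact hx
  | cons hab _ ih => exact ih (hS _ hx _ hab)

/-- Every minimal vertex cover of `G` has the smallest possible size. -/
def IsUnmixed (G : SimpleGraph V) : Prop :=
  ∀ C D : Finset V, Minimal (fun D : Finset V => G.IsVertexCover (D : Set V)) C →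
    G.IsVertexCover (D : Set V) → C.card ≤ D.card

/-- To check that a modification of a vertex cover is a vertex cover, it suffices to look at the
removed vertices. -/
lemma isVertexCover_of_forall_adj {C D : Set V} (hC : G.IsVertexCover C)
    (hD : ∀ a ∈ C, a ∉ D → ∀ b, G.Adj a b → b ∈ D) : G.IsVertexCover D := by
  intro a b hab
  by_contra! hcon
  rcases hC hab with h | h
  · exact hcon.2 (hD a h hcon.1 b hab)
  · exact hcon.1 (hD b h hcon.2 a hab.symm)

namespace IsMatchingStructure

variable {U : Set V} {τ : V → V}

/-- Otherwise `{x, τ x}` is closed under adjacency; by connectedness `G` is a single edge, a star.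
-/
lemma exists_adj (h : IsMatchingStructure G U τ) (hG : G.Connected) (hstar : ¬ IsStar G) {x : V} (hx : x ∉ U) :
    (∃ u ∈ U, G.Adj u x) ∨ ∃ u ∈ U, G.Adj u (τ x) := by
  by_contra! hcon
  obtain ⟨h1, h2⟩ := hcon
  have hall : ∀ y, y ∈ ({x, τ x} : Set V) := by
    refine mem_of_adj_closed hG (x := x) (by simp) ?_
    rintro a (rfl | rfl) b hab
    · by_cases hb : b ∈ U
      · exact absurd hab.symm (h1 b hb)
      · exact Or.inr (h.induced _ hx _ hb hab)
    · by_cases hb : b ∈ U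
      · exact absurd hab.symm (h2 b hb)
      · exact Or.inl ((h.induced _ (h.notMem x hx) _ hb hab).trans (h.invol x hx))
  refine hstar ⟨x, fun v w => ⟨fun hvw => ⟨hvw.ne, ?_⟩, ?_⟩⟩
  · by_contra! hne
    exact hvw.ne (((hall v).resolve_left hne.1).trans ((hall w).resolve_left hne.2).symm)
  · rintro ⟨hne, rfl | rfl⟩
    · rw [(hall w).resolve_left hne.symm]
      exact h.adj _ hx
    · rw [(hall v).resolve_left hne]
      exact (h.adj _ hx).symm

lemma tau_injOn (h : IsMatchingStructure G U τ) {x y : V} (hx : x ∉ U) (hy : y ∉ U)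
    (hxy : τ x = τ y) : x = y := by
  rw [← h.invol x hx, hxy, h.invol y hy]

/-- Without a triangle at `u`, no matching edge lies inside its neighbourhood `N`, so some minimal
cover avoids `N`. It contains `u` and `τ(N)`; exchanging these for `N` gives a cover with one vertex
fewer, against unmixedness. -/
lemma exists_triangle [Finite V] (h : IsMatchingStructure G U τ) (hG : G.Connected)
    (hstar : ¬ IsStar G) (hunm : IsUnmixed G) {u : V} (hu : u ∈ U) :
    ∃ x ∉ U, G.Adj u x ∧ G.Adj u (τ x) := by
  classical
  cases nonempty_fintype V
  by_contra! hcon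
  obtain ⟨s, hs⟩ : ∃ s, G.Adj u s := by
    by_contra! hno
    have hall : ∀ y, y ∈ ({u} : Set V) := by
      refine mem_of_adj_closed hG (x := u) (by simp) ?_
      rintro a rfl b hab
      exact absurd hab (hno b)
    refine hstar ⟨u, fun v w => ?_⟩
    rw [show v = u from hall v, show w = u from hall w]
    simp
  let N : Finset V := Finset.univ.filter fun x => G.Adj u x
  have hN : ∀ x, x ∈ N ↔ G.Adj u x := fun x => by simp [N]
  have hNU : ∀ x ∈ N, x ∉ U := fun x hx hxU => h.indep u hu x hxU ((hN x).1 hx)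
  have hcov : G.IsVertexCover ((Nᶜ : Finset V) : Set V) := by
    intro a b hab
    by_contra! hn
    simp only [Finset.coe_compl, Set.mem_compl_iff, Finset.mem_coe, not_not] at hn
    have := h.induced a (hNU a hn.1) b (hNU b hn.2) hab
    subst this
    exact hcon a (hNU a hn.1) ((hN a).1 hn.1) ((hN _).1 hn.2)
  obtain ⟨C, hCle, hC⟩ := exists_minimal_le_of_wellFoundedLT
    (fun D : Finset V => G.IsVertexCover (D : Set V)) _ hcov
  have hNC : ∀ x ∈ N, x ∉ C := fun x hx hxC => Finset.mem_compl.1 (hCle hxC) hx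
  have huC : u ∈ C := (hC.1 hs).resolve_right (hNC s ((hN s).2 hs))
  have hsub : insert u (N.image τ) ⊆ C := by
    intro y hy
    rcases Finset.mem_insert.1 hy with rfl | hy
    · exact huC
    · obtain ⟨x, hx, rfl⟩ := Finset.mem_image.1 hy
      exact (hC.1 (h.adj x (hNU x hx))).resolve_left (hNC x hx)
  have hcard : (insert u (N.image τ)).card = N.card + 1 := by
    rw [Finset.card_insert_of_notMem, Finset.card_image_of_injOn]
    · exact fun x hx y hy hxy => h.tau_injOn (hNU x hx) (hNU y hy) hxy
    · intro hmem
      obtain ⟨x, hx, rfl⟩ := Finset.mem_image.1 hmem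
      exact h.notMem x (hNU x hx) hu
  have hD : G.IsVertexCover (((C \ insert u (N.image τ)) ∪ N : Finset V) : Set V) := by
    refine isVertexCover_of_forall_adj hC.1 fun a ha haD b hab => ?_
    rw [Finset.mem_coe] at ha haD ⊢
    simp only [Finset.mem_union, Finset.mem_sdiff, ha, true_and, not_or, not_not] at haD
    refine Finset.mem_union_right _ ?_
    rcases Finset.mem_insert.1 haD.1 with rfl | haN
    · exact (hN b).2 hab
    · obtain ⟨x, hx, rfl⟩ := Finset.mem_image.1 haN
      have hxU := hNU x hx
      by_cases hb : b ∈ U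
      -- The only possible neighbour of `τ x` in `U` is `u`, which would create a triangle; its only
      -- neighbour outside `U` is `x ∈ N`.
      · have := h.unique x hxU u hu b hb ((hN x).1 hx) hab.symm
        subst this
        exact absurd hab.symm (hcon x hxU ((hN x).1 hx))
      · rw [h.induced _ (h.notMem x hxU) b hb hab, h.invol x hxU]
        exact hx
  have h1 := hunm C _ hC hD
  have h2 := Finset.card_union_le (C \ insert u (N.image τ)) N
  rw [Finset.card_sdiff_of_subset hsub] at h2
  have h3 := Finset.card_le_card hsub
  omega

/-- A minimal cover avoiding `u` contains both ends of each matching edge opposite `u`. With two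
such edges, exchanging one end of each for `u` alone yields a smaller cover. -/
lemma triangle_unique [Finite V] (h : IsMatchingStructure G U τ) (hunm : IsUnmixed G) {u x y : V}
    (hu : u ∈ U) (hx : x ∉ U) (hy : y ∉ U) (hux : G.Adj u x) (hux' : G.Adj u (τ x))
    (huy : G.Adj u y) (huy' : G.Adj u (τ y)) : y = x ∨ y = τ x := by
  classical
  cases nonempty_fintype V
  by_contra! hne
  have hcov : G.IsVertexCover (({u}ᶜ : Finset V) : Set V) := by
    intro a b hab
    by_contra! hn
    simp only [Finset.coe_compl, Finset.coe_singleton, Set.mem_compl_iff, Set.mem_singleton_iff,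
      not_not] at hn
    exact hab.ne (hn.1.trans hn.2.symm)
  obtain ⟨C, hCle, hC⟩ := exists_minimal_le_of_wellFoundedLT
    (fun D : Finset V => G.IsVertexCover (D : Set V)) _ hcov
  have huC : u ∉ C := fun huC => by simpa using hCle huC
  have hnb : ∀ z, G.Adj u z → z ∈ C := fun z hz => (hC.1 hz).resolve_left huC
  have hsub : {τ x, τ y} ⊆ C := by
    intro z hz
    rw [Finset.mem_insert, Finset.mem_singleton] at hz
    rcases hz with rfl | rfl
    · exact hnb _ hux'
    · exact hnb _ huy'
  have hcard : ({τ x, τ y} : Finset V).card = 2 :=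
    Finset.card_pair fun heq => hne.1 (h.tau_injOn hx hy heq).symm
  have hyx : τ y ≠ x := fun heq => hne.2 (by rw [← heq, h.invol y hy])
  have hD : G.IsVertexCover ((insert u (C \ {τ x, τ y}) : Finset V) : Set V) := by
    refine isVertexCover_of_forall_adj hC.1 fun a ha haD b hab => ?_
    rw [Finset.mem_coe] at ha haD ⊢
    simp only [Finset.mem_insert, Finset.mem_sdiff, ha, true_and, not_or, not_and_or, not_not,
      Finset.mem_singleton] at haD ⊢
    rcases haD.2 with rfl | rfl
    · by_cases hb : b ∈ U
      · exact Or.inl (h.unique x hx u hu b hb hux hab.symm).symm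
      · rw [h.induced _ (h.notMem x hx) b hb hab, h.invol x hx]
        exact Or.inr ⟨hnb x hux, (h.adj x hx).ne, hyx.symm⟩
    · by_cases hb : b ∈ U
      · exact Or.inl (h.unique y hy u hu b hb huy hab.symm).symm
      · rw [h.induced _ (h.notMem y hy) b hb hab, h.invol y hy]
        exact Or.inr ⟨hnb y huy, hne.2, (h.adj y hy).ne⟩
  have h1 := hunm C _ hC hD
  have h2 := Finset.card_insert_le u (C \ {τ x, τ y})
  rw [Finset.card_sdiff_of_subset hsub] at h2
  have h3 := Finset.card_le_card hsub
  omega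

open BlockVertex in
-- The apexes are the unmatched vertices, and `β u` selects one end of the matching edge in the
-- triangle at `u`. Stems are the matched vertices with a neighbour in `U` whose partners have none.
lemma exists_leafTriangleDecomposition [Finite V] (h : IsMatchingStructure G U τ)
    (hG : G.Connected) (hstar : ¬ IsStar G) (hunm : IsUnmixed G) :
    Nonempty (LeafTriangleDecomposition G
      {x // x ∉ U ∧ (∃ u ∈ U, G.Adj u x) ∧ ¬ ∃ u ∈ U, G.Adj u (τ x)} U) := by
  choose β hβU hβ hβ' using fun u : U => h.exists_triangle hG hstar hunm u.2
  have hβinj : ∀ u v : U, β u = β v → u = v := fun u v huv =>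
    Subtype.ext (h.unique _ (hβU u) u u.2 v v.2 (hβ u) (huv ▸ hβ' v))
  have hβne : ∀ u v : U, β u ≠ τ (β v) := by
    intro u v huv
    have : v = u := Subtype.ext (h.unique _ (hβU v) v v.2 u u.2 (hβ v) (huv ▸ hβ u))
    subst this
    exact (h.adj _ (hβU v)).ne huv
  let f : BlockVertex {x // x ∉ U ∧ (∃ u ∈ U, G.Adj u x) ∧ ¬ ∃ u ∈ U, G.Adj u (τ x)} U → V
    | stem i => i
    | leaf i => τ i
    | apex j => j
    | left j => β j
    | right j => τ (β j)
  have hinj : Function.Injective f := by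
    rintro (i | i | i | i | i) (j | j | j | j | j) hij <;> simp only [f] at hij
    · exact congrArg stem (Subtype.ext hij)
    · exact absurd (hij ▸ i.2.2.1) j.2.2.2
    · exact absurd (hij ▸ j.2) i.2.1
    · exact absurd ⟨j, j.2, hij ▸ hβ' j⟩ i.2.2.2
    · exact absurd ⟨j, j.2, by rw [hij, h.invol _ (hβU j)]; exact hβ j⟩ i.2.2.2
    · exact absurd (hij ▸ j.2.2.1) i.2.2.2
    · exact congrArg leaf (Subtype.ext (h.tau_injOn i.2.1 j.2.1 hij))
    · exact absurd (hij ▸ j.2) (h.notMem _ i.2.1)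
    · exact absurd ⟨j, j.2, hij ▸ hβ j⟩ i.2.2.2
    · exact absurd ⟨j, j.2, hij ▸ hβ' j⟩ i.2.2.2
    · exact absurd (hij ▸ i.2) j.2.1
    · exact absurd (hij ▸ i.2) (h.notMem _ j.2.1)
    · exact congrArg apex (Subtype.ext hij)
    · exact absurd (hij ▸ i.2) (hβU j)
    · exact absurd (hij ▸ i.2) (h.notMem _ (hβU j))
    · exact absurd ⟨i, i.2, hij ▸ hβ' i⟩ j.2.2.2
    · exact absurd ⟨i, i.2, hij ▸ hβ i⟩ j.2.2.2
    · exact absurd (hij ▸ j.2) (hβU i)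
    · exact congrArg left (hβinj i j hij)
    · exact absurd hij (hβne i j)
    · exact absurd ⟨i, i.2, by rw [← hij, h.invol _ (hβU i)]; exact hβ i⟩ j.2.2.2
    · exact absurd ⟨i, i.2, hij ▸ hβ' i⟩ j.2.2.2
    · exact absurd (hij ▸ j.2) (h.notMem _ (hβU i))
    · exact absurd hij.symm (hβne j i)
    · exact congrArg right (hβinj i j (h.tau_injOn (hβU i) (hβU j) hij))
  have hsurj : Function.Surjective f := by
    intro x
    by_cases hx : x ∈ U
    · exact ⟨apex ⟨x, hx⟩, rfl⟩
    by_cases h1 : ∃ u ∈ U, G.Adj u x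
    · by_cases h2 : ∃ u ∈ U, G.Adj u (τ x)
      · obtain ⟨u, hu, hux⟩ := h1
        obtain ⟨u', hu', hux'⟩ := h2
        -- If both ends of a matching edge see `U`, they see the same `u`, so the edge is the one in
        -- the unique triangle at `u`.
        have := h.unique x hx u hu u' hu' hux hux'
        subst this
        rcases h.triangle_unique hunm hu (hβU ⟨u, hu⟩) hx (hβ ⟨u, hu⟩) (hβ' ⟨u, hu⟩) hux hux'
          with h3 | h3
        · exact ⟨left ⟨u, hu⟩, h3.symm⟩
        · exact ⟨right ⟨u, hu⟩, h3.symm⟩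
      · exact ⟨stem ⟨x, hx, h1, h2⟩, rfl⟩
    · have h2 := (h.exists_adj hG hstar hx).resolve_left h1
      exact ⟨leaf ⟨τ x, h.notMem x hx, h2, by rwa [h.invol x hx]⟩, h.invol x hx⟩
  refine ⟨⟨Equiv.ofBijective f ⟨hinj, hsurj⟩, fun i => h.adj _ i.2.1, fun j => hβ j, fun j => hβ' j,
    fun j => h.adj _ (hβU j), ?_⟩⟩
  -- Edges between matched vertices are matching edges, so they stay in one block; all other edges
  -- involve an apex and are treated by `hapex`.
  have hopp : ∀ x, f x ∉ U → ∃ y, f y = τ (f x) ∧ x.Compatible y := by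
    rintro (i | i | j | j | j) hx
    · exact ⟨leaf i, rfl, rfl⟩
    · exact ⟨stem i, (h.invol _ i.2.1).symm, rfl⟩
    · exact absurd j.2 hx
    · exact ⟨right j, rfl, rfl⟩
    · exact ⟨left j, (h.invol _ (hβU j)).symm, rfl⟩
  have hmem : ∀ x, f x ∈ U → ∃ j, x = apex j := fun x hx => ⟨⟨f x, hx⟩, hinj rfl⟩
  have hapex : ∀ j x, G.Adj (f (apex j)) (f x) → (apex j).Compatible x := by
    rintro j (i | i | i | i | i) hij
    · trivial
    · exact i.2.2.2 ⟨j, j.2, hij⟩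
    · exact h.indep _ j.2 _ i.2 hij
    · exact Subtype.ext (h.unique _ (hβU i) j j.2 i i.2 hij (hβ' i))
    · exact Subtype.ext (h.unique _ (hβU i) i i.2 j j.2 (hβ i) hij).symm
  have hsymm : ∀ x y : BlockVertex {x // x ∉ U ∧ (∃ u ∈ U, G.Adj u x) ∧ ¬ ∃ u ∈ U, G.Adj u (τ x)} U,
      x.Compatible y → y.Compatible x := by
    rintro (_ | _ | _ | _ | _) (_ | _ | _ | _ | _) <;> simp +contextual [Compatible]
  intro x y hxy
  change G.Adj (f x) (f y) at hxy
  by_cases hx : f x ∈ U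
  · obtain ⟨j, rfl⟩ := hmem x hx
    exact hapex j y hxy
  by_cases hy : f y ∈ U
  · obtain ⟨j, rfl⟩ := hmem y hy
    exact hsymm _ _ (hapex j x hxy.symm)
  obtain ⟨z, hz, hxz⟩ := hopp x hx
  rwa [hinj ((h.induced _ hx _ hy hxy).trans hz.symm)]

end IsMatchingStructure

end Matchings

end CoverIdeal

theorem mainTheorem5 (K : Type*) [Field K] {V : Type*} [Fintype V] (G : SimpleGraph V)
    (hCW : CoverIdeal.IsCameronWalker G) (hCM : CoverIdeal.IsCohenMacaulayGraph K G) (k : ℕ) :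
    CoverIdeal.HasLinearResolution (CoverIdeal.coverIdeal K G ^ k) := by
  obtain ⟨U, τ, h⟩ := CoverIdeal.exists_isMatchingStructure hCW.inducedMatchingNumber_eq
  obtain ⟨D⟩ := h.exists_leafTriangleDecomposition hCW.connected hCW.not_isStar
    fun _ _ => CoverIdeal.IsCohenMacaulayGraph.card_le_card K G hCM
  exact D.hasLinearResolution_coverIdeal_pow K k
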